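/- Let $d\ge 0$ and let $x_{n+1}=x_n+a(n)\,[h(x_n)+M_{n+1}]$, $n\ge 0$, be $\mathbb R^d$-valued stochastic approximation iterates on a probability space, with $x_0$ a random vector and $\mathcal F_n=\sigma(x_0,M_1,\dots,M_n)$. Assume: (A1) $h:\mathbb R^d\to\mathbb R^d$ is locally Lipschitz. (A2) $a(n)\ge 0$, $\sum_n a(n)=\infty$ and $\sum_n a(n)^2<\infty$. (A3) Each $M_{n+1}$ is square integrable with $E[M_{n+1}\mid\mathcal F_n]=0$ a.s., and there is a locally bounded measurable $f:\mathbb R^d\to[0,\infty)$ with $E[\|M_{n+1}\|^2\mid\mathcal F_n]\le f(x_n)$ a.s. for all $n\ge 0$. (A4) $W:\mathbb R^d\to[0,\infty)$ is continuously differentiable, $W(x)\to\infty$ as $\|x\|\to\infty$, and there is a positive integer $M$ such that $h(x)\cdot\nabla W(x)<0$ whenever $W(x)\ge M$. (A5) $W$ is twice continuously differentiable and all its second order partial derivatives are bounded in absolute value by a constant. Suppose moreover that $$\sup_{x\in\mathbb R^d}\frac{\|h(x)\|^2+f(x)}{1\vee W(x)}=c_\infty<\infty$$ (which holds in particular if $\sup_x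 \frac{\|h(x)\|^2+f(x)}{1\wedge W(x)}<\infty$). Then: (a) $g\equiv 1$ is an admissible scaling of the step sizes, with $N=\infty$. Here, for $M<N\le\infty$ and $H^m=\{x: W(x)<m\}$ (so $H^\infty=\mathbb R^d$), a locally bounded measurable function $g:\mathbb R^d\to\mathbb R$ is called admissible if there is a finite constant $c_N>1\vee\sup_{y\in\overline{H^N}\setminus H^M}\frac{\|h(y)\|^2+f(y)}{W(y)}$, and $g(y)\ge 1\vee\Big(\mathbb I\{W(y)>N\}\sqrt{\tfrac{\|h(y)\|^2+f(y)}{W(y)}}\Big)$ for all $y$; the scaled step sizes are $a(n)/g(x_n)$. Thus no scaling of the step sizes is needed. (b) Almost surely, the original iterates $(x_n)$ converge to a (possibly sample path dependent) internally chain transitive set $A$ of the o.d.e. $\dot x=h(x)$, that is, $\operatorname{dist}(x_n,A)\to 0$. Here $A$ is internally chain transitive if it is nonempty, compact, invariant (the solution through each point of $A$ exists for all $t\in\mathbb R$ and stays in $A$), and for all $u,v\in A$, $\varepsilon>0$, $T>0$ there are $n\ge1$ and points $u=p_0,p_1,\dots,p_n=v$ in $A$ such that for each $i<n$ the solution started at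 $p_i$ is within distance less than $\varepsilon$ of $p_{i+1}$ at some time $t\ge T$. -/

import Mathlib

open Filter Topology MeasureTheory ProbabilityTheory
open scoped ENNReal

/-- The `σ`-algebra `𝓕 n = σ(x₀, M 1, …, M n)`. -/
abbrev noiseSigma {Ω E : Type*} [MeasurableSpace E] (x₀ : Ω → E) (M : ℕ → Ω → E) (n : ℕ) :
    MeasurableSpace Ω :=
  MeasurableSpace.comap x₀ inferInstance ⊔
    ⨆ k ∈ Finset.Icc 1 n, MeasurableSpace.comap (M k) inferInstance

/-- A real function is locally bounded if it is bounded on a neighbourhood of every point. -/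
def IsLocallyBounded {E : Type*} [TopologicalSpace E] (f : E → ℝ) : Prop :=
  ∀ x, ∃ C : ℝ, ∀ᶠ y in 𝓝 x, |f y| ≤ C

/-- All second order partial derivatives of `W : ℝᵈ → ℝ` are bounded in absolute value by one
constant. -/
def HasBoundedSecondDerivatives {d : ℕ} (W : EuclideanSpace ℝ (Fin d) → ℝ) : Prop :=
  ∃ C : ℝ, ∀ (x : EuclideanSpace ℝ (Fin d)) (i j : Fin d),
    |iteratedFDeriv ℝ 2 W x ![EuclideanSpace.single i 1, EuclideanSpace.single j 1]| ≤ C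

/-- The level set `H^N = {x | W x < N}` of a nonnegative function, for `N` a natural number or `∞`
(so `H^∞` is the whole space). -/
def levelSet {E : Type*} (W : E → ℝ) (N : ℕ∞) : Set E :=
  {x | ENNReal.ofReal (W x) < (N : ℝ≥0∞)}

/-- `g` is an admissible step-size scaling for the drift `h`, the noise bound `f`, the Lyapunov
function `W` and the level `L`, with parameters `N ∈ (L, ∞]` and `c = c_N ∈ (1, ∞)`:
`c` is strictly larger than `1` and than the supremum of `(‖h‖² + f) / W` over
`closure H^N \ H^L`, and `g` is locally bounded and measurable, with
`g ≥ max 1 (𝟙{W > N} √((‖h‖² + f) / W))`. The scaled step sizes are then `a n / g (x n)`. -/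
structure IsAdmissibleScaling {E : Type*} [NormedAddCommGroup E] [MeasurableSpace E]
    (h : E → E) (f W : E → ℝ) (L : ℕ) (N : ℕ∞) (c : ℝ) (g : E → ℝ) : Prop where
  level_lt : (L : ℕ∞) < N
  one_lt : 1 < c
  sup_lt : ∃ s < c, ∀ y ∈ closure (levelSet W N) \ levelSet W L, (‖h y‖ ^ 2 + f y) / W y ≤ s
  measurable : Measurable g
  locallyBounded : IsLocallyBounded g
  one_le : ∀ y, 1 ≤ g y
  sqrt_le : ∀ y, (N : ℝ≥0∞) < ENNReal.ofReal (W y) → √((‖h y‖ ^ 2 + f y) / W y) ≤ g y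

/-- `A` is an internally chain transitive set of the o.d.e. `ẋ = h x` (with `h` locally Lipschitz,
so that solutions are unique): `A` is nonempty, compact and invariant (the solution through each of
its points is defined for all times `t ∈ ℝ` and stays in `A`), and any two points `u, v` of `A` are
joined, for all `ε, T > 0`, by a finite chain `u = p 0, p 1, …, p n = v` of points of `A`, `n ≥ 1`,
such that the solution started at `p i` is `ε`-close to `p (i + 1)` at some time `t ≥ T`. -/
structure IsInternallyChainTransitive {E : Type*} [NormedAddCommGroup E] [NormedSpace ℝ E]
    (h : E → E) (A : Set E) : Prop where
  nonempty : A.Nonempty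
  isCompact : IsCompact A
  invariant : ∀ u ∈ A, ∃ φ : ℝ → E,
    IsIntegralCurve φ (fun _ => h) ∧ φ 0 = u ∧ ∀ t, φ t ∈ A
  chain : ∀ u ∈ A, ∀ v ∈ A, ∀ ε > (0 : ℝ), ∀ T > (0 : ℝ),
    ∃ (n : ℕ) (p : ℕ → E), 1 ≤ n ∧ p 0 = u ∧ p n = v ∧ (∀ i ≤ n, p i ∈ A) ∧
      ∀ i < n, ∃ φ : ℝ → E, IsIntegralCurve φ (fun _ => h) ∧ φ 0 = p i ∧
        ∃ t ≥ T, dist (φ t) (p (i + 1)) < ε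

/-! The proof separates a deterministic limit set theorem from two almost sure statements.

Deterministic part: let `z` be the partial sums of the weighted noise. If the iterates are bounded
and `z` is Cauchy, they are an Euler scheme with vanishing steps and asymptotically negligible
perturbation, so over any fixed time window they eventually shadow the flow
(`eventually_dist_flow_le`, a discrete Grönwall argument). Cutting the tail of the trajectory into
windows and replacing each endpoint by a nearby cluster point gives invariance and chains inside the
cluster set (`isInternallyChainTransitive_mapClusterPt`). Bounded iterates see `h` only on a ball,
so `h` may be replaced by a bounded Lipschitz field with a global flow.

Stability: `W` decreases along `h` only at high levels, so it is flattened below level `L` to a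
function `U` with Lipschitz derivative and `DU(h) ≤ 0` everywhere (`exists_flattened_lyapunov`). A
Taylor estimate and the growth condition bound the conditional expectation of `1 + U` at the next
step by `1 + O(a n ^ 2)` times its current value. After division by a convergent product this is a
nonnegative supermartingale, so `U`, and by coercivity the iterates, stay bounded
(`ae_bddAbove_range_lyapunov`).

Noise: truncated to the times when the iterate lies in a fixed ball, the weighted noise has summable
second moments, so its partial sums converge; on a bounded path a large enough ball makes the
truncation invisible (`ae_cauchySeq_sum_noise`).

Admissibility of the constant scaling is elementary: above level `L ≥ 1` the denominators `max 1 (W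
y)` and `W y` agree. -/

section Flow

/-! ### Bounded Lipschitz vector fields and their flows. -/

variable {E : Type*} [NormedAddCommGroup E] [NormedSpace ℝ E]

/-- A locally Lipschitz vector field on a finite dimensional space agrees on any given ball with a
bounded, globally Lipschitz one. -/
theorem LocallyLipschitz.exists_bounded_lipschitzWith_eqOn_closedBall [FiniteDimensional ℝ E]
    {h : E → E} (hh : LocallyLipschitz h) (R : ℝ) :
    ∃ (g : E → E) (K B : NNReal), LipschitzWith K g ∧ (∀ x, ‖g x‖ ≤ B) ∧
      Set.EqOn g h (Metric.closedBall 0 R) := by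
  have : ProperSpace E := FiniteDimensional.proper ℝ E
  obtain ⟨K₀, hK₀⟩ := LocallyLipschitzOn.exists_lipschitzOnWith_of_compact
    (isCompact_closedBall (0 : E) R) hh.locallyLipschitzOn
  obtain ⟨k, hk, hkh⟩ := hK₀.extend_finite_dimension
  set K := lipschitzExtensionConstant E * K₀
  obtain ⟨G, hG⟩ := (isCompact_closedBall (0 : E) (R + 1)).exists_bound_of_continuousOn
    hk.continuous.continuousOn
  -- A 1-Lipschitz cutoff, equal to 1 on the ball of radius `R` and to 0 off the ball of radius `R +
  -- 1`; multiplying by it makes the extension bounded.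
  set χ : E → ℝ := fun x => max 0 (min 1 (R + 1 - ‖x‖)) with hχ
  have hχ0 : ∀ x, 0 ≤ χ x := fun x => le_max_left _ _
  have hχ1 : ∀ x, χ x ≤ 1 := fun x => max_le zero_le_one (min_le_left _ _)
  have hχ_out : ∀ x, x ∉ Metric.closedBall (0 : E) (R + 1) → χ x = 0 := fun x hx => by
    simp only [Metric.mem_closedBall, dist_zero_right, not_le] at hx
    exact max_eq_left ((min_le_right _ _).trans (by linarith))
  have hχL : ∀ x y, |χ x - χ y| ≤ ‖x - y‖ := fun x y => by
    refine (abs_max_sub_max_le_max _ _ _ _).trans (max_le (by simp) ?_)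
    refine (abs_min_sub_min_le_max _ _ _ _).trans (max_le (by simp) ?_)
    rw [sub_sub_sub_cancel_left, norm_sub_rev]
    exact abs_norm_sub_norm_le y x
  have hG' : ∀ x ∈ Metric.closedBall (0 : E) (R + 1), ‖k x‖ ≤ |G| :=
    fun x hx => (hG x hx).trans (le_abs_self G)
  -- The splitting needs a bound on `k` only at `y`, so one point in the larger ball suffices; if
  -- both points lie outside, both values vanish.
  have key : ∀ x y, y ∈ Metric.closedBall (0 : E) (R + 1) →
      ‖χ x • k x - χ y • k y‖ ≤ (K + |G|) * ‖x - y‖ := fun x y hy => by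
    have e : χ x • k x - χ y • k y = χ x • (k x - k y) + (χ x - χ y) • k y := by
      rw [smul_sub, sub_smul]; abel
    rw [e, add_mul]
    refine (norm_add_le _ _).trans (add_le_add ?_ ?_)
    · rw [norm_smul, Real.norm_of_nonneg (hχ0 x)]
      calc χ x * ‖k x - k y‖ ≤ 1 * ‖k x - k y‖ := by gcongr; exact hχ1 x
        _ ≤ K * ‖x - y‖ := by rw [one_mul]; exact hk.norm_sub_le x y
    · rw [norm_smul, mul_comm, Real.norm_eq_abs]
      gcongr
      · exact hG' y hy
      · exact hχL x y
  refine ⟨fun x => χ x • k x, K + ‖G‖₊, ‖G‖₊, LipschitzWith.of_dist_le_mul fun x y => ?_,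
    fun x => ?_, fun x hx => ?_⟩
  · simp only [dist_eq_norm, NNReal.coe_add, coe_nnnorm, Real.norm_eq_abs]
    by_cases hy : y ∈ Metric.closedBall (0 : E) (R + 1)
    · exact key x y hy
    by_cases hx : x ∈ Metric.closedBall (0 : E) (R + 1)
    · rw [norm_sub_rev, norm_sub_rev x y]
      exact key y x hx
    · simp only [hχ_out x hx, hχ_out y hy, zero_smul, sub_self, norm_zero]
      positivity
  · by_cases hx : x ∈ Metric.closedBall (0 : E) (R + 1)
    · rw [norm_smul, Real.norm_of_nonneg (hχ0 x)]
      calc χ x * ‖k x‖ ≤ 1 * |G| := by gcongr; exacts [hχ1 x, hG' x hx]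
        _ = _ := by simp
    · simp [hχ_out x hx]
  · have hx' : ‖x‖ ≤ R := by simpa using hx
    have : χ x = 1 := by
      simp only [hχ]
      rw [min_eq_left (by linarith), max_eq_right zero_le_one]
    simp only [this, one_smul]
    exact (hkh hx).symm

/-- A bounded Lipschitz vector field is complete. -/
theorem LipschitzWith.exists_isIntegralCurve [CompleteSpace E] {g : E → E} {K B : NNReal}
    (hg : LipschitzWith K g) (hB : ∀ x, ‖g x‖ ≤ B) (x : E) :
    ∃ φ : ℝ → E, φ 0 = x ∧ IsIntegralCurve φ fun _ => g := by
  have hloc : ∀ n : ℕ, ∃ α : ℝ → E, α 0 = x ∧ ∀ t ∈ Set.Icc (-(n : ℝ)) n,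
      HasDerivWithinAt α (g (α t)) (Set.Icc (-(n : ℝ)) n) t := fun n => by
    have h0 : (0 : ℝ) ∈ Set.Icc (-(n : ℝ)) n := by simp
    -- Speed at most `B` keeps the solution within radius `B * n` up to time `n`, so the
    -- Picard–Lindelöf condition holds on the whole interval.
    have : IsPicardLindelof (fun _ => g) (⟨0, h0⟩ : Set.Icc (-(n : ℝ)) n) x (B * n) 0 B K :=
      { lipschitzOnWith := fun _ _ => hg.lipschitzOnWith
        continuousOn := fun _ _ => continuousOn_const
        norm_le := fun _ _ y _ => hB y
        mul_max_le := by simp }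
    exact this.exists_eq_forall_mem_Icc_hasDerivWithinAt₀
  choose α hα0 hα using hloc
  have hα' : ∀ (n : ℕ) (t : ℝ), |t| < n → HasDerivAt (α n) (g (α n t)) t := fun n t ht => by
    rw [abs_lt] at ht
    exact (hα n t ⟨ht.1.le, ht.2.le⟩).hasDerivAt (Icc_mem_nhds ht.1 ht.2)
  have huniq : ∀ (n m : ℕ) (t : ℝ), |t| < n → n ≤ m → α n t = α m t := fun n m t ht hnm => by
    have hn : (0 : ℝ) < n := (abs_nonneg t).trans_lt ht
    have hnm' : (n : ℝ) ≤ m := by exact_mod_cast hnm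
    refine ODE_solution_unique_of_mem_Ioo (v := fun _ => g) (s := fun _ => Set.univ) (K := K)
      (a := -n) (b := n) (t₀ := 0) (fun _ _ => hg.lipschitzOnWith) ⟨by linarith, hn⟩
      (fun s hs => ⟨hα' n s (abs_lt.2 hs), trivial⟩)
      (fun s hs => ⟨hα' m s ((abs_lt.2 hs).trans_le hnm'), trivial⟩)
      ((hα0 n).trans (hα0 m).symm) (abs_lt.1 ht)
  have hidx : ∀ t : ℝ, |t| < ((⌊|t|⌋₊ + 1 : ℕ) : ℝ) := fun t => by
    push_cast; exact Nat.lt_floor_add_one _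
  refine ⟨fun t => α (⌊|t|⌋₊ + 1) t, hα0 _, fun t => ?_⟩
  set N := ⌊|t|⌋₊ + 1 with hN
  have hev : (fun s => α (⌊|s|⌋₊ + 1) s) =ᶠ[𝓝 t] α N := by
    have : ∀ᶠ s : ℝ in 𝓝 t, |s| < N := continuous_abs.continuousAt.eventually_lt
      continuousAt_const (hidx t)
    filter_upwards [this] with s hs
    refine huniq _ _ s (hidx s) ?_
    have := (Nat.floor_lt (abs_nonneg s)).2 hs
    omega
  simpa using (hα' N t (hidx t)).congr_of_eventuallyEq hev

theorem IsIntegralCurve.norm_sub_le {g : E → E} {φ : ℝ → E} {B : NNReal}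
    (hφ : IsIntegralCurve φ fun _ => g) (hB : ∀ x, ‖g x‖ ≤ B) (s t : ℝ) :
    ‖φ t - φ s‖ ≤ B * |t - s| :=
  convex_univ.norm_image_sub_le_of_norm_hasDerivWithin_le
    (fun u _ => (hφ u).hasDerivWithinAt) (fun _ _ => hB _) trivial trivial

/-- The error of one step of the Euler scheme. -/
theorem IsIntegralCurve.norm_sub_sub_smul_le {g : E → E} {φ : ℝ → E} {K B : NNReal}
    (hφ : IsIntegralCurve φ fun _ => g) (hg : LipschitzWith K g) (hB : ∀ x, ‖g x‖ ≤ B)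
    (s : ℝ) {τ : ℝ} (hτ : 0 ≤ τ) :
    ‖φ (s + τ) - φ s - τ • g (φ s)‖ ≤ K * B * τ * τ := by
  have hd : ∀ u ∈ Set.Icc s (s + τ), HasDerivWithinAt (fun u => φ u - u • g (φ s))
      (g (φ u) - g (φ s)) (Set.Icc s (s + τ)) u := fun u _ => by
    have := ((hφ u).sub ((hasDerivAt_id u).smul_const (g (φ s)))).hasDerivWithinAt
      (s := Set.Icc s (s + τ))
    rwa [one_smul] at this
  have hb : ∀ u ∈ Set.Icc s (s + τ), ‖g (φ u) - g (φ s)‖ ≤ K * B * τ := fun u hu => by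
    refine (hg.norm_sub_le _ _).trans ?_
    rw [mul_assoc]
    gcongr
    refine (hφ.norm_sub_le hB s u).trans ?_
    gcongr
    rw [abs_of_nonneg (by linarith [hu.1])]
    linarith [hu.2]
  have := (convex_Icc s (s + τ)).norm_image_sub_le_of_norm_hasDerivWithin_le hd hb
    (Set.left_mem_Icc.2 (by linarith)) (Set.right_mem_Icc.2 (by linarith))
  rw [add_sub_cancel_left, Real.norm_of_nonneg hτ] at this
  convert this using 2
  rw [add_smul]; abel

theorem IsIntegralCurve.dist_le {g : E → E} {φ ψ : ℝ → E} {K : NNReal}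
    (hφ : IsIntegralCurve φ fun _ => g) (hψ : IsIntegralCurve ψ fun _ => g)
    (hg : LipschitzWith K g) {t : ℝ} (ht : 0 ≤ t) :
    dist (φ t) (ψ t) ≤ dist (φ 0) (ψ 0) * Real.exp (K * t) := by
  simpa using dist_le_of_trajectories_ODE (v := fun _ => g) (fun _ => hg)
    (fun u _ => (hφ u).continuousAt.continuousWithinAt) (fun u _ => (hφ u).hasDerivWithinAt)
    (fun u _ => (hψ u).continuousAt.continuousWithinAt) (fun u _ => (hψ u).hasDerivWithinAt)
    le_rfl t ⟨ht, le_rfl⟩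

end Flow

/-! ### Shadowing and the limit set theorem. -/

section LimitSet

variable {E : Type*} [NormedAddCommGroup E] [NormedSpace ℝ E]

/-- Perturbed Euler iterates shadow the flow on bounded time windows. -/
theorem eventually_dist_flow_le {g : E → E} {K B : NNReal} (hg : LipschitzWith K g)
    (hB : ∀ x, ‖g x‖ ≤ B) {Φ : E → ℝ → E} (hΦ0 : ∀ x, Φ x 0 = x)
    (hΦ : ∀ x, IsIntegralCurve (Φ x) fun _ => g) {a : ℕ → ℝ} (ha : ∀ n, 0 ≤ a n)
    (ha0 : Tendsto a atTop (𝓝 0)) {x z : ℕ → E} (hz : CauchySeq z)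
    (hx : ∀ n, x (n + 1) = x n + a n • g (x n) + (z (n + 1) - z n))
    (T : ℝ) {ε : ℝ} (hε : 0 < ε) :
    ∃ N, ∀ n ≥ N, ∀ m ≥ n, ∑ i ∈ Finset.Ico n m, a i ≤ T →
      dist (x m) (Φ (x n) (∑ i ∈ Finset.Ico n m, a i)) ≤ ε := by
  obtain ⟨δ, hδ, hδε⟩ : ∃ δ > 0, δ + δ * (K * (1 + B) * |T| * Real.exp (K * |T|)) ≤ ε := by
    set c := K * (1 + B) * |T| * Real.exp (K * |T|)
    have hc : 0 ≤ c := by positivity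
    refine ⟨ε / (1 + c), by positivity, le_of_eq ?_⟩
    field_simp
  obtain ⟨N₁, hN₁⟩ := Metric.cauchySeq_iff.1 hz δ hδ
  obtain ⟨N₂, hN₂⟩ := eventually_atTop.1 (ha0.eventually (gt_mem_nhds hδ))
  refine ⟨max N₁ N₂, fun n hn m hm hT => ?_⟩
  set t : ℕ → ℝ := fun k => ∑ i ∈ Finset.Ico n k, a i with ht
  have ht_succ : ∀ k ≥ n, t (k + 1) = t k + a k := fun k hk =>
    Finset.sum_Ico_succ_top hk _
  have ht0 : ∀ k, 0 ≤ t k := fun k => Finset.sum_nonneg fun i _ => ha i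
  -- Removing the accumulated noise from the error leaves a recursion driven only by the Lipschitz
  -- and Euler errors, each at most `a k` times a multiple of `δ`; the noise is added back once, at
  -- the end.
  set e : ℕ → E := fun k => x k - Φ (x n) (t k) - (z k - z n) with he
  have hzn : ∀ k ≥ n, ‖z k - z n‖ ≤ δ := fun k hk => by
    rw [← dist_eq_norm]
    exact (hN₁ k (by omega) n (by omega)).le
  have hrec : ∀ k ≥ n, ‖e (k + 1)‖ ≤ (1 + K * a k) * ‖e k‖ + a k * (K * (1 + B) * δ) := by
    intro k hk
    have hak : a k ≤ δ := (hN₂ k (by omega)).le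
    set y := Φ (x n) (t k)
    set r := Φ (x n) (t k + a k) - y - a k • g y with hr
    have h1 : e (k + 1) = e k + a k • (g (x k) - g y) - r := by
      simp only [he, ht_succ k hk, hx k, hr]
      rw [smul_sub]; abel
    have h2 : ‖r‖ ≤ a k * (K * B * δ) := by
      refine ((hΦ (x n)).norm_sub_sub_smul_le hg hB (t k) (ha k)).trans ?_
      rw [mul_comm (a k)]
      gcongr
      exact ha k
    have h3 : ‖x k - y‖ ≤ ‖e k‖ + δ := by
      have : x k - y = e k + (z k - z n) := by simp only [he, y]; abel
      rw [this]
      exact (norm_add_le _ _).trans (by gcongr; exact hzn k hk)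
    have h4 : ‖a k • (g (x k) - g y)‖ ≤ a k * (K * (‖e k‖ + δ)) := by
      rw [norm_smul, Real.norm_of_nonneg (ha k)]
      have := ha k
      gcongr
      exact (hg.norm_sub_le _ _).trans (by gcongr)
    rw [h1]
    calc ‖e k + a k • (g (x k) - g y) - r‖ ≤ ‖e k‖ + ‖a k • (g (x k) - g y)‖ + ‖r‖ :=
          (norm_sub_le _ _).trans (by gcongr; exact norm_add_le _ _)
      _ ≤ ‖e k‖ + a k * (K * (‖e k‖ + δ)) + a k * (K * B * δ) := by gcongr
      _ = _ := by ring
  have hgr := discrete_gronwall (u := fun k => ‖e k‖) (c := fun k => K * a k) (n₀ := n)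
    (norm_nonneg _) hrec (fun k _ => mul_nonneg K.2 (ha k))
    (fun k _ => mul_nonneg (ha k) (by positivity)) hm
  have hen : e n = 0 := by simp [he, ht, hΦ0]
  simp only [hen, norm_zero, zero_add, ← Finset.sum_mul, ← Finset.mul_sum] at hgr
  have hT' : t m ≤ |T| := hT.trans (le_abs_self T)
  have hem : ‖e m‖ ≤ δ * (K * (1 + B) * |T| * Real.exp (K * |T|)) := by
    refine hgr.trans ?_
    calc t m * (K * (1 + B) * δ) * Real.exp (K * t m)
        ≤ |T| * (K * (1 + B) * δ) * Real.exp (K * |T|) := by gcongr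
      _ = _ := by ring
  have hfin : x m - Φ (x n) (t m) = (z m - z n) + e m := by simp only [he]; abel
  rw [dist_eq_norm, hfin]
  exact (norm_add_le _ _).trans ((add_le_add (hzn m hm) hem).trans hδε)

/-- Partial sums of small nonnegative steps hit every late enough time window. -/
theorem exists_sum_range_mem_Icc {a : ℕ → ℝ}
    (ha_sum : Tendsto (fun n => ∑ i ∈ Finset.range n, a i) atTop atTop) {N : ℕ} {η c : ℝ}
    (hη0 : 0 ≤ η) (hη : ∀ k ≥ N, a k ≤ η) (hc : ∑ i ∈ Finset.range N, a i ≤ c) :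
    ∃ m ≥ N, c ≤ ∑ i ∈ Finset.range m, a i ∧ ∑ i ∈ Finset.range m, a i ≤ c + η ∧
      ∀ n ≥ N, c ≤ ∑ i ∈ Finset.range n, a i → m ≤ n := by
  classical
  have hex : ∃ m, N ≤ m ∧ c ≤ ∑ i ∈ Finset.range m, a i := by
    obtain ⟨m, h1, h2⟩ := ((eventually_ge_atTop N).and (ha_sum.eventually_ge_atTop c)).exists
    exact ⟨m, h1, h2⟩
  obtain ⟨h1, h2⟩ := Nat.find_spec hex
  refine ⟨Nat.find hex, h1, h2, ?_, fun n hn hcn => Nat.find_min' hex ⟨hn, hcn⟩⟩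
  rcases h1.eq_or_lt with h | h
  · rw [← h]; linarith
  · obtain ⟨k, hk⟩ : ∃ k, Nat.find hex = k + 1 := ⟨Nat.find hex - 1, by omega⟩
    have h3 := Nat.find_min hex (m := k) (by omega)
    have hNk : N ≤ k := by omega
    simp only [hNk, true_and, not_le] at h3
    rw [hk, Finset.sum_range_succ]
    linarith [hη k hNk]

theorem mapClusterPt_atTop_iff_dist {X : Type*} [PseudoMetricSpace X] {x : ℕ → X} {u : X} :
    MapClusterPt u atTop x ↔ ∀ ε > 0, ∀ N, ∃ n ≥ N, dist (x n) u < ε := by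
  simp only [Metric.nhds_basis_ball.mapClusterPt_iff_frequently, frequently_atTop,
    Metric.mem_ball]

/-- A sequence in a compact set approaches its set of cluster points. -/
theorem IsCompact.eventually_infDist_mapClusterPt_lt {X : Type*} [PseudoMetricSpace X]
    {S : Set X} (hS : IsCompact S) {x : ℕ → X} (hx : ∀ n, x n ∈ S) {δ : ℝ} (hδ : 0 < δ) :
    ∀ᶠ n in atTop, Metric.infDist (x n) {u | MapClusterPt u atTop x} < δ := by
  by_contra hcon
  rw [not_eventually] at hcon
  set A := {u | MapClusterPt u atTop x}
  have hcl : IsClosed {y | δ ≤ Metric.infDist y A} :=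
    isClosed_le continuous_const (Metric.continuous_infDist_pt A)
  have hfr : ∃ᶠ n in atTop, x n ∈ S ∩ {y | δ ≤ Metric.infDist y A} :=
    hcon.mono fun n hn => ⟨hx n, not_lt.1 hn⟩
  obtain ⟨u, hu, huA⟩ := (hS.inter_right hcl).exists_mapClusterPt_of_frequently hfr
  have : Metric.infDist u A = 0 := Metric.infDist_zero_of_mem huA
  have h2 : δ ≤ Metric.infDist u A := hu.2
  linarith

/-- Chains are built by concatenation and only indexed here; the irreflexive closure `TransGen` is
what supplies `1 ≤ n`. -/
theorem Relation.TransGen.exists_chain {X : Type*} {r : X → X → Prop} {u v : X}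
    (h : Relation.TransGen r u v) :
    ∃ (n : ℕ) (p : ℕ → X), 1 ≤ n ∧ p 0 = u ∧ p n = v ∧ ∀ i < n, r (p i) (p (i + 1)) := by
  induction h using Relation.TransGen.head_induction_on with
  | @single b hb =>
    refine ⟨1, fun i => if i = 0 then b else v, le_rfl, by simp, by simp, fun i hi => ?_⟩
    obtain rfl : i = 0 := by omega
    simpa using hb
  | @head b c hbc _ ih =>
    obtain ⟨n, p, hn, hp0, hpn, hp⟩ := ih
    refine ⟨n + 1, fun i => i.casesOn b p, by omega, rfl, hpn, fun i hi => ?_⟩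
    cases i with
    | zero => simpa [hp0] using hbc
    | succ i => exact hp i (by omega)

/-- The limit set theorem for asymptotic pseudotrajectories of stochastic approximation type:
the set of cluster points of a bounded perturbed Euler scheme is internally chain transitive. -/
theorem isInternallyChainTransitive_mapClusterPt [FiniteDimensional ℝ E]
    {h : E → E} (hh : LocallyLipschitz h) {a : ℕ → ℝ} (ha : ∀ n, 0 ≤ a n)
    (ha0 : Tendsto a atTop (𝓝 0))
    (ha_sum : Tendsto (fun n => ∑ i ∈ Finset.range n, a i) atTop atTop)
    {x z : ℕ → E} (hz : CauchySeq z)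
    (hx : ∀ n, x (n + 1) = x n + a n • h (x n) + (z (n + 1) - z n))
    {R : ℝ} (hR : ∀ n, ‖x n‖ ≤ R) :
    IsInternallyChainTransitive h {u | MapClusterPt u atTop x} ∧
      Tendsto (fun n => Metric.infDist (x n) {u | MapClusterPt u atTop x}) atTop (𝓝 0) := by
  have : ProperSpace E := FiniteDimensional.proper ℝ E
  obtain ⟨g, K, B, hg, hB, hgh⟩ := hh.exists_bounded_lipschitzWith_eqOn_closedBall R
  choose Φ hΦ0 hΦ using hg.exists_isIntegralCurve hB
  have hxS : ∀ n, x n ∈ Metric.closedBall (0 : E) R := fun n => by simpa using hR n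
  have hS := isCompact_closedBall (0 : E) R
  have hxg : ∀ n, x (n + 1) = x n + a n • g (x n) + (z (n + 1) - z n) := fun n => by
    rw [hgh (hxS n), hx n]
  have hshadow := fun T ε (hε : 0 < ε) =>
    eventually_dist_flow_le hg hB hΦ0 hΦ ha ha0 hz hxg T hε
  set A := {u | MapClusterPt u atTop x} with hA
  have hdist : ∀ δ > 0, ∃ N, ∀ n ≥ N, ∃ q ∈ A, dist (x n) q < δ := fun δ hδ => by
    -- `Metric.infDist` to the empty set is 0, so a cluster point must be exhibited before small
    -- distances mean anything.
    obtain ⟨u, _, hu⟩ := hS.exists_mapClusterPt_of_frequently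
      (Frequently.of_forall (f := atTop) hxS)
    obtain ⟨N, hN⟩ := eventually_atTop.1 (hS.eventually_infDist_mapClusterPt_lt hxS hδ)
    exact ⟨N, fun n hn => (Metric.infDist_lt_iff ⟨u, hu⟩).1 (hN n hn)⟩
  have hAne : A.Nonempty := by
    obtain ⟨N, hN⟩ := hdist 1 one_pos
    obtain ⟨q, hq, _⟩ := hN N le_rfl
    exact ⟨q, hq⟩
  have hAS : A ⊆ Metric.closedBall (0 : E) R := fun u hu =>
    Metric.isClosed_closedBall.mem_of_mapClusterPt hu (Eventually.of_forall hxS)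
  have hAcl : IsClosed A := isClosed_setOfPred_clusterPt
  have hAc : IsCompact A := hS.of_isClosed_subset hAcl hAS
  have hsum : ∀ {n m : ℕ}, n ≤ m → ∑ i ∈ Finset.Ico n m, a i =
      ∑ i ∈ Finset.range m, a i - ∑ i ∈ Finset.range n, a i := fun hnm =>
    Finset.sum_Ico_eq_sub _ hnm
  have hflow : ∀ (p q : E) (T s : ℝ), 0 ≤ s → s ≤ T →
      dist (Φ p s) (Φ q s) ≤ dist p q * Real.exp (K * T) := fun p q T s hs hsT => by
    have := (hΦ p).dist_le (hΦ q) hg hs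
    rw [hΦ0, hΦ0] at this
    exact this.trans (by gcongr)
  have htime : ∀ (p : E) (s t η : ℝ), |s - t| ≤ η → dist (Φ p s) (Φ p t) ≤ B * η :=
    fun p s t η hst => by
      rw [dist_eq_norm]
      exact ((hΦ p).norm_sub_le hB t s).trans (by gcongr)
  have hstep : ∀ η > 0, ∃ N, ∀ k ≥ N, a k ≤ η := fun η hη =>
    eventually_atTop.1 ((ha0.eventually (gt_mem_nhds hη)).mono fun _ => le_of_lt)
  have hη : ∀ ε > (0 : ℝ), ∃ η > (0 : ℝ), η ≤ 1 ∧ B * η ≤ ε / 4 := fun ε hε => by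
    refine ⟨min 1 (ε / (4 * (B + 1))), by positivity, min_le_left _ _, ?_⟩
    calc (B : ℝ) * min 1 (ε / (4 * (B + 1))) ≤ (B + 1) * (ε / (4 * (B + 1))) := by
          gcongr
          · linarith
          · exact min_le_right _ _
      _ = ε / 4 := by field_simp
  -- Start at an iterate near `u` and run it for time about `t`: the iterate reached is close to `Φ
  -- u t`, with errors from shadowing, the initial gap and the overshoot of the window.
  have hfwd : ∀ u ∈ A, ∀ t ≥ 0, Φ u t ∈ A := fun u hu t ht => by
    refine mapClusterPt_atTop_iff_dist.2 fun ε hε N => ?_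
    obtain ⟨η, hη0, hη1, hηε⟩ := hη ε hε
    obtain ⟨N₁, hN₁⟩ := hshadow (t + 1) (ε / 4) (by positivity)
    obtain ⟨N₂, hN₂⟩ := hstep η hη0
    obtain ⟨n, hn, hnu⟩ := mapClusterPt_atTop_iff_dist.1 hu
      (ε / (4 * Real.exp (K * (t + 1)))) (by positivity) (max N (max N₁ N₂))
    obtain ⟨m, hm, h1, h2, -⟩ := exists_sum_range_mem_Icc (N := n) ha_sum hη0.le
      (fun k hk => hN₂ k (by omega)) (le_add_of_nonneg_right ht)
    have hs := hsum hm
    set s := ∑ i ∈ Finset.Ico n m, a i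
    refine ⟨m, by omega, ?_⟩
    have d1 := hN₁ n (by omega) m hm (by linarith)
    have d2 := hflow (x n) u (t + 1) s (by linarith) (by linarith)
    have d3 := htime u s t η (by rw [abs_le]; constructor <;> linarith)
    have d4 : dist (x n) u * Real.exp (K * (t + 1)) < ε / 4 := by
      rw [← lt_div_iff₀ (Real.exp_pos _), div_div]; exact hnu
    calc dist (x m) (Φ u t) ≤ dist (x m) (Φ (x n) s) + dist (Φ (x n) s) (Φ u s)
          + dist (Φ u s) (Φ u t) := dist_triangle4 _ _ _ _
      _ < ε := by linarith
  -- Run the argument backwards from an iterate near `u`: the iterate about time `t` earlier is near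
  -- some `q ∈ A`, so `Φ q t` is near `u`. The time-`t` image of `A` is compact, hence closed, and
  -- thus contains `u`.
  have hbwd : ∀ u ∈ A, ∀ t ≥ 0, ∃ w ∈ A, Φ w t = u := fun u hu t ht => by
    have hcont : Continuous fun p => Φ p t :=
      (LipschitzWith.of_dist_le_mul (K := (Real.exp (K * t)).toNNReal) fun p q => by
        rw [Real.coe_toNNReal _ (Real.exp_pos _).le, mul_comm]
        exact hflow p q t t ht le_rfl).continuous
    have hcl : u ∈ closure ((fun p => Φ p t) '' A) := by
      refine Metric.mem_closure_iff.2 fun ε hε => ?_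
      obtain ⟨η, hη0, hη1, hηε⟩ := hη ε hε
      obtain ⟨N₁, hN₁⟩ := hshadow t (ε / 4) (by positivity)
      obtain ⟨N₂, hN₂⟩ := hstep η hη0
      obtain ⟨N₃, hN₃⟩ := hdist (ε / (4 * Real.exp (K * t))) (by positivity)
      set N := max N₁ (max N₂ N₃)
      obtain ⟨N₄, hN₄⟩ := eventually_atTop.1
        (ha_sum.eventually_ge_atTop (∑ i ∈ Finset.range N, a i + t))
      obtain ⟨n, hn, hnu⟩ := mapClusterPt_atTop_iff_dist.1 hu (ε / 4) (by positivity) (max N N₄)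
      have hc := hN₄ n (by omega)
      obtain ⟨m, hm, h1, h2, h3⟩ := exists_sum_range_mem_Icc (N := N)
        (c := ∑ i ∈ Finset.range n, a i - t) ha_sum hη0.le
        (fun k hk => hN₂ k (by omega)) (by linarith)
      have hmn := h3 n (by omega) (by linarith)
      have hs := hsum hmn
      have hs0 : 0 ≤ ∑ i ∈ Finset.Ico m n, a i := Finset.sum_nonneg fun i _ => ha i
      set s := ∑ i ∈ Finset.Ico m n, a i
      obtain ⟨q, hq, hqm⟩ := hN₃ m (by omega)
      refine ⟨_, ⟨q, hq, rfl⟩, ?_⟩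
      have d1 := hN₁ m (by omega) n hmn (by linarith)
      have d2 := hflow (x m) q t s hs0 (by linarith)
      have d3 := htime q s t η (by rw [abs_le]; constructor <;> linarith)
      have d4 : dist (x m) q * Real.exp (K * t) < ε / 4 := by
        rw [← lt_div_iff₀ (Real.exp_pos _), div_div]; exact hqm
      calc dist u (Φ q t) ≤ dist u (x n) + dist (x n) (Φ q t) := dist_triangle _ _ _
        _ ≤ dist u (x n) + (dist (x n) (Φ (x m) s) + dist (Φ (x m) s) (Φ q s)
            + dist (Φ q s) (Φ q t)) := by gcongr; exact dist_triangle4 _ _ _ _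
        _ < ε := by rw [dist_comm u]; linarith
    rwa [(hAc.image hcont).isClosed.closure_eq] at hcl
  have hinv : ∀ u ∈ A, ∀ t, Φ u t ∈ A := fun u hu t => by
    rcases le_total 0 t with ht | ht
    · exact hfwd u hu t ht
    · obtain ⟨w, hw, hwu⟩ := hbwd u hu (-t) (by linarith)
      have h1 : IsIntegralCurve (fun s => Φ w (s + -t)) fun _ => g := fun s => by
        simpa using (hΦ w (s + -t)).comp_add_const s (-t)
      have h2 : (fun s => Φ w (s + -t)) = Φ u :=
        ODE_solution_unique_univ (v := fun _ => g) (s := fun _ => Set.univ) (K := K) (t₀ := 0)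
          (fun _ => hg.lipschitzOnWith) (fun s => ⟨h1 s, trivial⟩) (fun s => ⟨hΦ u s, trivial⟩)
          (by simp [hwu, hΦ0])
      rw [← h2]
      simpa [hΦ0] using hw
  have hcurve : ∀ u ∈ A, IsIntegralCurve (Φ u) fun _ => h := fun u hu t => by
    have := hΦ u t
    simp only [hgh (hAS (hinv u hu t))] at this
    exact this
  refine ⟨⟨hAne, hAc, fun u hu => ⟨Φ u, hcurve u hu, hΦ0 u, hinv u hu⟩,
    fun u hu v hv ε hε T hT => ?_⟩, ?_⟩
  -- Windows have length between `T` and `2 * T + 1`. With steps at most 1, a longer stretch splits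
  -- at the first time past `T`: the first piece lasts at most `T + 1`, and more than `T` remains
  -- for the induction.
  · set C := Real.exp (K * (2 * T + 1)) with hC
    have hC1 : 1 ≤ C := Real.one_le_exp (by positivity)
    obtain ⟨δ, hδ, hδε⟩ : ∃ δ > 0, δ * C = ε / 4 := ⟨ε / 4 / C, by positivity, by field_simp⟩
    have hδ' : δ ≤ ε / 4 := by nlinarith
    obtain ⟨N₁, hN₁⟩ := hshadow (2 * T + 1) (ε / 4) (by positivity)
    obtain ⟨N₂, hN₂⟩ := hstep 1 one_pos
    obtain ⟨N₃, hN₃⟩ := hdist δ hδ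
    set r : E → E → Prop := fun p q => p ∈ A ∧ q ∈ A ∧ ∃ t ≥ T, dist (Φ p t) q < ε with hr
    have hclaim : ∀ (l n m : ℕ), m - n ≤ l → max N₁ (max N₂ N₃) ≤ n → n ≤ m →
        T ≤ ∑ i ∈ Finset.range m, a i - ∑ i ∈ Finset.range n, a i →
        ∀ p ∈ A, dist (x n) p < δ → ∀ q ∈ A, dist (x m) q < δ → Relation.TransGen r p q := by
      intro l
      induction l with
      | zero =>
        intro n m hl hn hnm hT' p hp hnp q hq hmq
        obtain rfl : n = m := by omega
        linarith
      | succ l ih =>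
        have hone : ∀ n m, max N₁ (max N₂ N₃) ≤ n → n ≤ m →
            T ≤ ∑ i ∈ Finset.range m, a i - ∑ i ∈ Finset.range n, a i →
            ∑ i ∈ Finset.range m, a i - ∑ i ∈ Finset.range n, a i ≤ 2 * T + 1 →
            ∀ p ∈ A, dist (x n) p < δ → ∀ q ∈ A, dist (x m) q < δ → r p q := by
          intro n m hn hnm hT1 hT2 p hp hnp q hq hmq
          rw [← hsum hnm] at hT1 hT2
          refine ⟨hp, hq, _, hT1, ?_⟩
          have d1 := hN₁ n (by omega) m hnm hT2
          have d2 := hflow p (x n) _ _ (hT.le.trans hT1) hT2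
          have d3 : dist p (x n) * C ≤ δ * C := by rw [dist_comm]; gcongr
          refine (dist_triangle4 _ (Φ (x n) (∑ i ∈ Finset.Ico n m, a i)) (x m) _).trans_lt ?_
          rw [dist_comm (Φ (x n) _)]
          linarith
        intro n m hl hn hnm hT' p hp hnp q hq hmq
        by_cases hT2 : ∑ i ∈ Finset.range m, a i - ∑ i ∈ Finset.range n, a i ≤ 2 * T + 1
        · exact .single (hone n m hn hnm hT' hT2 p hp hnp q hq hmq)
        · obtain ⟨k, hk, h1, h2, h3⟩ := exists_sum_range_mem_Icc (N := n) ha_sum zero_le_one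
            (fun k hk => hN₂ k (by omega)) (le_add_of_nonneg_right hT.le)
          have hkm := h3 m hnm (by linarith)
          have hkn : k ≠ n := by rintro rfl; linarith
          obtain ⟨w, hw, hkw⟩ := hN₃ k (by omega)
          exact .head (hone n k hn hk (by linarith) (by linarith) p hp hnp w hw hkw)
            (ih k m (by omega) (by omega) hkm (by linarith) w hw hkw q hq hmq)
    obtain ⟨n, hn, hnu⟩ := mapClusterPt_atTop_iff_dist.1 hu δ hδ (max N₁ (max N₂ N₃))
    obtain ⟨N₄, hN₄⟩ := eventually_atTop.1
      (ha_sum.eventually_ge_atTop (∑ i ∈ Finset.range n, a i + T))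
    obtain ⟨m, hm, hmv⟩ := mapClusterPt_atTop_iff_dist.1 hv δ hδ (max n N₄)
    obtain ⟨l, p, hl, hp0, hpl, hp⟩ := (hclaim (m - n) n m le_rfl hn (by omega)
      (by linarith [hN₄ m (by omega)]) u hu hnu v hv hmv).exists_chain
    refine ⟨l, p, hl, hp0, hpl, fun i hi => ?_, fun i hi => ?_⟩
    · rcases hi.eq_or_lt with rfl | hi
      · rwa [hpl]
      · exact (hp i hi).1
    · obtain ⟨hpi, -, ht⟩ := hp i hi
      exact ⟨Φ (p i), hcurve _ hpi, hΦ0 _, ht⟩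
  · rw [Metric.tendsto_atTop]
    intro ε hε
    obtain ⟨N, hN⟩ := eventually_atTop.1 (hS.eventually_infDist_mapClusterPt_lt hxS hε)
    refine ⟨N, fun n hn => ?_⟩
    rw [Real.dist_0_eq_abs, abs_of_nonneg Metric.infDist_nonneg]
    exact hN n hn

end LimitSet

/-! ### Descent inequality and flattening of the Lyapunov function. -/

section Lyapunov

theorem HasBoundedSecondDerivatives.exists_lipschitzWith_fderiv {d : ℕ}
    {W : EuclideanSpace ℝ (Fin d) → ℝ} (hW : HasBoundedSecondDerivatives W)
    (hW2 : ContDiff ℝ 2 W) : ∃ K : NNReal, LipschitzWith K (fderiv ℝ W) := by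
  obtain ⟨C, hC⟩ := hW
  have hdiff : Differentiable ℝ (fderiv ℝ W) :=
    (hW2.fderiv_right (m := 1) (by norm_num)).differentiable (by norm_num)
  -- The Hessian is expanded in the standard basis, giving `d * d` terms. The absolute value of `C`
  -- matters for `d = 0`, where `C` may be negative.
  refine ⟨‖(d : ℝ) * (d * |C|)‖₊, lipschitzWith_of_nnnorm_fderiv_le hdiff fun y => ?_⟩
  rw [← NNReal.coe_le_coe, coe_nnnorm, coe_nnnorm, Real.norm_of_nonneg (by positivity)]
  have hbasis : ∀ i j, |fderiv ℝ (fderiv ℝ W) y (EuclideanSpace.single i 1)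
      (EuclideanSpace.single j 1)| ≤ |C| := fun i j => by
    have := hC y i j
    rw [iteratedFDeriv_two_apply] at this
    exact this.trans (le_abs_self C)
  have hsum : ∀ v : EuclideanSpace ℝ (Fin d), v = ∑ i, v i • EuclideanSpace.single i (1 : ℝ) :=
    fun v => by
      conv_lhs => rw [← (EuclideanSpace.basisFun (Fin d) ℝ).sum_repr v]
      simp
  have hcoord : ∀ (v : EuclideanSpace ℝ (Fin d)) i, |v i| ≤ ‖v‖ := fun v i =>
    PiLp.norm_apply_le v i
  refine ContinuousLinearMap.opNorm_le_bound₂ _ (by positivity) fun v w => ?_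
  have hv : fderiv ℝ (fderiv ℝ W) y v w = ∑ i, ∑ j, v i * (w j *
      fderiv ℝ (fderiv ℝ W) y (EuclideanSpace.single i 1) (EuclideanSpace.single j 1)) := by
    conv_lhs => rw [hsum v, hsum w]
    simp only [map_sum, map_smul, sum_apply, smul_apply, smul_eq_mul, Finset.mul_sum]
    rw [Finset.sum_comm]
    exact Finset.sum_congr rfl fun i _ => Finset.sum_congr rfl fun j _ => by ring
  rw [hv, Real.norm_eq_abs]
  calc |∑ i, ∑ j, v i * (w j * fderiv ℝ (fderiv ℝ W) y (EuclideanSpace.single i 1)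
        (EuclideanSpace.single j 1))|
      ≤ ∑ i : Fin d, ∑ j : Fin d, ‖v‖ * (‖w‖ * |C|) := by
        refine (Finset.abs_sum_le_sum_abs _ _).trans (Finset.sum_le_sum fun i _ => ?_)
        refine (Finset.abs_sum_le_sum_abs _ _).trans (Finset.sum_le_sum fun j _ => ?_)
        rw [abs_mul, abs_mul]
        exact mul_le_mul (hcoord v i) (mul_le_mul (hcoord w j) (hbasis i j) (abs_nonneg _)
          (norm_nonneg _)) (by positivity) (norm_nonneg _)
    _ = d * (d * |C|) * ‖v‖ * ‖w‖ := by
        simp only [Finset.sum_const, Finset.card_univ, Fintype.card_fin, nsmul_eq_mul]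
        ring

/-- The descent inequality for functions with Lipschitz derivative. -/
theorem LipschitzWith.le_add_fderiv_add_sq {E : Type*} [NormedAddCommGroup E] [NormedSpace ℝ E]
    {U : E → ℝ} (hU : Differentiable ℝ U) {K : NNReal} (hK : LipschitzWith K (fderiv ℝ U))
    (y v : E) : U (y + v) ≤ U y + fderiv ℝ U y v + K * ‖v‖ ^ 2 := by
  -- Mean value inequality for `U` minus its linear part at `y`, whose derivative is at most `K *
  -- ‖v‖` on this ball; the sharp factor 1/2 is not needed.
  have := (convex_closedBall y ‖v‖).norm_image_sub_le_of_norm_hasFDerivWithin_le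
    (f := fun w => U w - fderiv ℝ U y w) (f' := fun w => fderiv ℝ U w - fderiv ℝ U y)
    (C := K * ‖v‖) (x := y) (y := y + v)
    (fun w _ => ((hU w).hasFDerivAt.sub (fderiv ℝ U y).hasFDerivAt).hasFDerivWithinAt)
    (fun w hw => (hK.norm_sub_le w y).trans (by gcongr; simpa [dist_eq_norm] using hw))
    (by simp) (by simp)
  rw [add_sub_cancel_left, map_add, Real.norm_eq_abs] at this
  have := (abs_le.1 this).2
  nlinarith

theorem hasDerivAt_max_zero_sq (t : ℝ) :
    HasDerivAt (fun s : ℝ => max s 0 ^ 2) (2 * max t 0) t := by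
  rcases lt_trichotomy t 0 with ht | rfl | ht
  · have : (fun s : ℝ => max s 0 ^ 2) =ᶠ[𝓝 t] fun _ => 0 := by
      filter_upwards [gt_mem_nhds ht] with s hs
      simp [max_eq_right hs.le]
    rw [max_eq_right ht.le, mul_zero]
    exact (hasDerivAt_const t (0 : ℝ)).congr_of_eventuallyEq this
  · rw [hasDerivAt_iff_isLittleO_nhds_zero]
    refine Asymptotics.IsBigO.trans_isLittleO (g := fun h : ℝ => h ^ 2) ?_
      (by simpa using Asymptotics.isLittleO_pow_id one_lt_two)
    refine Asymptotics.IsBigO.of_bound 1 (Eventually.of_forall fun s => ?_)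
    rcases le_total s 0 with hs | hs
    · simp [hs]; positivity
    · simp [hs]
  · have : (fun s : ℝ => max s 0 ^ 2) =ᶠ[𝓝 t] fun s => s ^ 2 := by
      filter_upwards [lt_mem_nhds ht] with s hs
      rw [max_eq_left hs.le]
    rw [max_eq_left ht.le]
    simpa using (hasDerivAt_pow 2 t).congr_of_eventuallyEq this

/-- This Huber-type primitive of the clipped identity is 0 for negative arguments, quadratic on `[0,
1]` and of slope 1 afterwards, so it flattens low levels yet still grows linearly. -/
theorem hasDerivAt_half_max_sq_sub_max_sq (w : ℝ) :
    HasDerivAt (fun s : ℝ => (max s 0 ^ 2 - max (s - 1) 0 ^ 2) / 2) (max 0 (min 1 w)) w := by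
  have h := ((hasDerivAt_max_zero_sq w).sub
    ((hasDerivAt_max_zero_sq (w - 1)).comp_sub_const w 1)).div_const 2
  have e : max 0 (min 1 w) = (2 * max w 0 - 2 * max (w - 1) 0) / 2 := by
    rcases le_total w 0 with h0 | h0
    · rw [min_eq_right (by linarith), max_eq_left h0, max_eq_right h0, max_eq_right (by linarith)]
      norm_num
    · rcases le_total w 1 with h1 | h1
      · rw [min_eq_right h1, max_eq_right h0, max_eq_left h0, max_eq_right (by linarith)]
        ring
      · rw [min_eq_left h1, max_eq_right zero_le_one, max_eq_left h0, max_eq_left (by linarith)]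
        ring
  rw [e]
  exact h

/-- Flattening a coercive Lyapunov function below a level keeps the derivative Lipschitz. -/
theorem exists_flattened_lyapunov {E : Type*} [NormedAddCommGroup E] [NormedSpace ℝ E]
    [ProperSpace E] {W : E → ℝ} (hW : Differentiable ℝ W) {K : NNReal}
    (hK : LipschitzWith K (fderiv ℝ W)) (hlim : Tendsto W (Bornology.cobounded E) atTop) (L : ℝ) :
    ∃ (U c : E → ℝ) (C : NNReal), Differentiable ℝ U ∧ LipschitzWith C (fderiv ℝ U) ∧
      (∀ y, 0 ≤ U y) ∧ (∀ y, W y ≤ U y + L + 1) ∧ (∀ y, 0 ≤ c y) ∧ (∀ y, W y < L → c y = 0) ∧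
      ∀ y, fderiv ℝ U y = c y • fderiv ℝ W y := by
  set ψ : ℝ → ℝ := fun w => max 0 (min 1 w) with hψ
  have hψ0 : ∀ w, 0 ≤ ψ w := fun w => le_max_left _ _
  have hψ1 : ∀ w, ψ w ≤ 1 := fun w => max_le zero_le_one (min_le_left _ _)
  have hψL : ∀ w w', |ψ w - ψ w'| ≤ |w - w'| := fun w w' =>
    (abs_max_sub_max_le_max _ _ _ _).trans (max_le (by simp)
      ((abs_min_sub_min_le_max _ _ _ _).trans (max_le (by simp) le_rfl)))
  set φ : ℝ → ℝ := fun s => (max s 0 ^ 2 - max (s - 1) 0 ^ 2) / 2 with hφ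
  have hU : ∀ y, HasFDerivAt (fun y => φ (W y - L)) (ψ (W y - L) • fderiv ℝ W y) y := fun y =>
    HasDerivAt.comp_hasFDerivAt (h₂ := φ) y (hasDerivAt_half_max_sq_sub_max_sq (W y - L))
      ((hW y).hasFDerivAt.sub_const L)
  have hfd : ∀ y, fderiv ℝ (fun y => φ (W y - L)) y = ψ (W y - L) • fderiv ℝ W y :=
    fun y => (hU y).fderiv
  -- Sublevel sets of `W` are relatively compact by coercivity, so the derivative is bounded where
  -- the cutoff can vary.
  obtain ⟨G, hG0, hG⟩ : ∃ G ≥ 0, ∀ y, W y ≤ L + 1 → ‖fderiv ℝ W y‖ ≤ G := by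
    obtain ⟨S, hS, hSW⟩ : ∃ S, IsCompact S ∧ ∀ y, W y ≤ L + 1 → y ∈ S := by
      have := hlim.eventually_gt_atTop (L + 1)
      rw [Metric.cobounded_eq_cocompact, Filter.eventually_iff, mem_cocompact] at this
      obtain ⟨S, hS, hSW⟩ := this
      refine ⟨S, hS, fun y hy => ?_⟩
      by_contra hyS
      exact absurd (hSW hyS) (not_lt.2 hy)
    obtain ⟨G, hG⟩ := hS.exists_bound_of_continuousOn hK.continuous.continuousOn
    exact ⟨|G|, abs_nonneg G, fun y hy => (hG y (hSW y hy)).trans (le_abs_self G)⟩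
  have hψW : ∀ x y, W x ≤ L + 1 → |ψ (W y - L) - ψ (W x - L)| ≤ (1 + G + K) * ‖y - x‖ := by
    intro x y hx
    rcases le_total ‖y - x‖ 1 with h1 | h1
    · refine (hψL _ _).trans ?_
      have hmv := (convex_closedBall x ‖y - x‖).norm_image_sub_le_of_norm_fderiv_le
        (f := W) (𝕜 := ℝ) (C := G + K) (x := x) (y := y) (fun w _ => hW w) (fun w hw => ?_)
        (by simp) (by simp [dist_eq_norm])
      · rw [Real.norm_eq_abs] at hmv
        rw [sub_sub_sub_cancel_right]
        refine hmv.trans ?_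
        gcongr
        linarith
      · have h2 : ‖fderiv ℝ W w - fderiv ℝ W x‖ ≤ K * 1 :=
          (hK.norm_sub_le w x).trans (by
            gcongr
            exact (by simpa [dist_eq_norm] using hw : ‖w - x‖ ≤ ‖y - x‖).trans h1)
        have h3 := norm_le_insert' (fderiv ℝ W w) (fderiv ℝ W x)
        linarith [hG x hx]
    · have h2 : |ψ (W y - L) - ψ (W x - L)| ≤ 1 := by
        rw [abs_le]
        constructor <;> linarith [hψ0 (W y - L), hψ1 (W y - L), hψ0 (W x - L), hψ1 (W x - L)]
      have : (0 : ℝ) ≤ K := K.2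
      nlinarith
  -- The cutoff difference is paired with the derivative at the lower point `x`: either `W x ≤ L +
  -- 1` and that derivative is bounded, or the cutoff is 1 at both points and the term vanishes.
  have key : ∀ x y, W x ≤ W y → ‖ψ (W y - L) • fderiv ℝ W y - ψ (W x - L) • fderiv ℝ W x‖ ≤
      (K + (1 + G + K) * G) * ‖y - x‖ := by
    intro x y hxy
    have e : ψ (W y - L) • fderiv ℝ W y - ψ (W x - L) • fderiv ℝ W x =
        ψ (W y - L) • (fderiv ℝ W y - fderiv ℝ W x) +
          (ψ (W y - L) - ψ (W x - L)) • fderiv ℝ W x := by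
      rw [smul_sub, sub_smul]; abel
    rw [e, add_mul]
    refine (norm_add_le _ _).trans (add_le_add ?_ ?_)
    · rw [norm_smul, Real.norm_of_nonneg (hψ0 _)]
      calc ψ (W y - L) * ‖fderiv ℝ W y - fderiv ℝ W x‖
          ≤ 1 * ‖fderiv ℝ W y - fderiv ℝ W x‖ := by gcongr; exact hψ1 _
        _ ≤ K * ‖y - x‖ := by rw [one_mul]; exact hK.norm_sub_le y x
    · rw [norm_smul, Real.norm_eq_abs]
      rcases le_total (W x) (L + 1) with hx | hx
      · calc _ ≤ ((1 + G + K) * ‖y - x‖) * G := by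
              gcongr
              exacts [hψW x y hx, hG x hx]
          _ = _ := by ring
      · have h1 : ∀ w, L + 1 ≤ w → ψ (w - L) = 1 := fun w hw => by
          simp only [hψ]
          rw [min_eq_left (by linarith), max_eq_right zero_le_one]
        rw [h1 _ hx, h1 _ (hx.trans hxy), sub_self, abs_zero, zero_mul]
        have : (0 : ℝ) ≤ K := K.2
        positivity
  refine ⟨fun y => φ (W y - L), fun y => ψ (W y - L), K + (1 + ⟨G, hG0⟩ + K) * ⟨G, hG0⟩,
    fun y => (hU y).differentiableAt, LipschitzWith.of_dist_le_mul fun x y => ?_, fun y => ?_,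
    fun y => ?_, fun y => hψ0 _, fun y hy => ?_, hfd⟩
  · rw [dist_eq_norm, dist_eq_norm, hfd, hfd]
    rcases le_total (W x) (W y) with hxy | hxy
    · rw [norm_sub_rev, norm_sub_rev x y]
      exact key x y hxy
    · exact key y x hxy
  · have h1 : max (W y - L - 1) 0 ≤ max (W y - L) 0 := max_le_max (by linarith) le_rfl
    have h2 : max (W y - L - 1) 0 ^ 2 ≤ max (W y - L) 0 ^ 2 := by gcongr
    simp only [hφ]
    linarith
  · simp only [hφ]
    rcases le_total (W y - L) 0 with h1 | h1
    · rw [max_eq_right h1, max_eq_right (by linarith)]; linarith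
    · rw [max_eq_left h1]
      rcases le_total (W y - L - 1) 0 with h2 | h2
      · rw [max_eq_right h2]; nlinarith
      · rw [max_eq_left h2]; nlinarith
  · simp only [hψ]
    exact max_eq_left ((min_le_right _ _).trans (by linarith))

end Lyapunov

/-! ### Martingale convergence tools. -/

theorem MeasureTheory.MemLp.integrable_clm_apply {Ω E : Type*} {mΩ : MeasurableSpace Ω}
    {μ : Measure Ω} [NormedAddCommGroup E] [NormedSpace ℝ E] {c : Ω → E →L[ℝ] ℝ} {X : Ω → E}
    (hc2 : MemLp c 2 μ) (hX2 : MemLp X 2 μ) : Integrable (fun ω => c ω (X ω)) μ := by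
  refine (hc2.norm.integrable_mul hX2.norm).mono' ?_ (Eventually.of_forall fun ω => ?_)
  · exact (ContinuousLinearMap.id ℝ (E →L[ℝ] ℝ)).aestronglyMeasurable_comp₂
      hc2.aestronglyMeasurable hX2.aestronglyMeasurable
  · exact (c ω).le_opNorm (X ω)

section Martingale

variable {Ω : Type*} {mΩ : MeasurableSpace Ω} {μ : Measure Ω} [IsProbabilityMeasure μ]

/-- A nonnegative almost supermartingale with summable relative increments is almost surely
bounded. -/
theorem ae_bddAbove_range_of_condExp_le {ℱ : Filtration ℕ mΩ} {V : ℕ → Ω → ℝ} {b : ℕ → ℝ}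
    (hV : StronglyAdapted ℱ V) (hint : ∀ n, Integrable (V n) μ) (hV0 : ∀ n ω, 0 ≤ V n ω)
    (hb : ∀ n, 0 ≤ b n) (hbs : Summable b)
    (hle : ∀ n, μ[V (n + 1) | ℱ n] ≤ᵐ[μ] fun ω => (1 + b n) * V n ω) :
    ∀ᵐ ω ∂μ, BddAbove (Set.range fun n => V n ω) := by
  -- Division by `P n` absorbs the growth factors and yields a supermartingale; since `P n` is at
  -- most `exp (∑' k, b k)`, bounds on the quotient transfer back.
  set P : ℕ → ℝ := fun n => ∏ k ∈ Finset.range n, (1 + b k) with hP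
  have hP0 : ∀ n, 0 < P n := fun n => Finset.prod_pos fun k _ => by linarith [hb k]
  have hPle : ∀ n, P n ≤ Real.exp (∑' k, b k) := fun n => by
    calc P n ≤ ∏ k ∈ Finset.range n, Real.exp (b k) :=
          Finset.prod_le_prod (fun k _ => by linarith [hb k])
            fun k _ => by linarith [Real.add_one_le_exp (b k)]
      _ = Real.exp (∑ k ∈ Finset.range n, b k) := (Real.exp_sum _ _).symm
      _ ≤ _ := Real.exp_le_exp.2 (hbs.sum_le_tsum _ fun k _ => hb k)
  set Z : ℕ → Ω → ℝ := fun n => (P n)⁻¹ • V n with hZ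
  have hZ0 : ∀ n ω, 0 ≤ Z n ω := fun n ω =>
    mul_nonneg (inv_nonneg.2 (hP0 n).le) (hV0 n ω)
  have hsuper : Supermartingale Z ℱ μ := by
    refine supermartingale_nat (fun n => (hV n).const_smul _) (fun n => (hint n).smul _)
      fun n => ?_
    filter_upwards [condExp_smul (P (n + 1))⁻¹ (V (n + 1)) (ℱ n) (μ := μ), hle n] with ω h1 h2
    rw [h1]
    simp only [hZ, Pi.smul_apply, smul_eq_mul]
    have h3 : P (n + 1) = P n * (1 + b n) := Finset.prod_range_succ _ _
    have h4 : 0 < 1 + b n := by linarith [hb n]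
    have h5 := hP0 n
    calc (P (n + 1))⁻¹ * (μ[V (n + 1) | ℱ n]) ω ≤ (P (n + 1))⁻¹ * ((1 + b n) * V n ω) :=
          mul_le_mul_of_nonneg_left h2 (inv_nonneg.2 (hP0 _).le)
      _ = (P n)⁻¹ * V n ω := by rw [h3]; field_simp
  have hbdd : ∀ n, eLpNorm ((-Z) n) 1 μ ≤ ((∫ ω, Z 0 ω ∂μ).toNNReal : ℝ≥0∞) := fun n => by
    rw [Pi.neg_apply, eLpNorm_neg, eLpNorm_one_eq_lintegral_enorm,
      ← ofReal_integral_norm_eq_lintegral_enorm (hsuper.integrable n)]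
    refine ENNReal.ofReal_le_ofReal ?_
    simp only [Real.norm_of_nonneg (hZ0 n _)]
    simpa using hsuper.setIntegral_le (Nat.zero_le n) MeasurableSet.univ
  filter_upwards [hsuper.neg.exists_ae_tendsto_of_bdd hbdd] with ω ⟨c, hc⟩
  obtain ⟨C, hC⟩ := hc.neg.bddAbove_range
  refine ⟨Real.exp (∑' k, b k) * |C|, ?_⟩
  rintro _ ⟨n, rfl⟩
  have h1 : Z n ω ≤ |C| := by
    have := hC ⟨n, rfl⟩
    simp only [Pi.neg_apply, neg_neg] at this
    exact this.trans (le_abs_self C)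
  have h2 : V n ω = P n * Z n ω := by
    simp only [hZ, Pi.smul_apply, smul_eq_mul]
    rw [mul_inv_cancel_left₀ (hP0 n).ne']
  simp only
  rw [h2]
  exact mul_le_mul (hPle n) h1 (hZ0 n ω) (Real.exp_pos _).le

/-- A series of square integrable martingale differences with summable second moments converges
almost surely. -/
theorem ae_exists_tendsto_sum_of_martingale_diff {ℱ : Filtration ℕ mΩ} {ξ : ℕ → Ω → ℝ}
    {c : ℕ → ℝ} (hξ : ∀ n, StronglyMeasurable[ℱ (n + 1)] (ξ n)) (hξ2 : ∀ n, MemLp (ξ n) 2 μ)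
    (hmart : ∀ n, μ[ξ n | ℱ n] =ᵐ[μ] 0) (hc : Summable c)
    (hle : ∀ n, ∫ ω, ξ n ω ^ 2 ∂μ ≤ c n) :
    ∀ᵐ ω ∂μ, ∃ l, Tendsto (fun n => ∑ k ∈ Finset.range n, ξ k ω) atTop (𝓝 l) := by
  set S : ℕ → Ω → ℝ := fun n ω => ∑ k ∈ Finset.range n, ξ k ω with hS
  have hSs : ∀ n, S (n + 1) = S n + ξ n := fun n => by
    funext ω; exact Finset.sum_range_succ _ _
  have hSm : StronglyAdapted ℱ S := fun n => Finset.stronglyMeasurable_fun_sum _ fun k hk =>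
    (hξ k).mono (ℱ.mono (Finset.mem_range.1 hk))
  have hS2 : ∀ n, MemLp (S n) 2 μ := fun n => memLp_finsetSum _ fun k _ => hξ2 k
  have hSint : ∀ n, Integrable (S n) μ := fun n => (hS2 n).integrable one_le_two
  have hξint : ∀ n, Integrable (ξ n) μ := fun n => (hξ2 n).integrable one_le_two
  have hM : Martingale S ℱ μ := by
    refine martingale_nat hSm hSint fun n => ?_
    rw [hSs]
    filter_upwards [condExp_add (hSint n) (hξint n) (ℱ n), hmart n] with ω h1 h2
    rw [h1, Pi.add_apply, h2, condExp_of_stronglyMeasurable (ℱ.le n) (hSm n) (hSint n)]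
    simp
  -- Orthogonality of the increments: the cross term has zero mean after conditioning on `ℱ n`.
  have hsq : ∀ n, ∫ ω, S n ω ^ 2 ∂μ ≤ ∑ k ∈ Finset.range n, c k := fun n => by
    induction n with
    | zero => simp [hS]
    | succ n ih =>
      have hprod : Integrable (fun ω => S n ω * ξ n ω) μ := (hS2 n).integrable_mul (hξ2 n)
      have h0 : ∫ ω, S n ω * ξ n ω ∂μ = 0 := by
        rw [← integral_condExp (ℱ.le n)]
        refine integral_eq_zero_of_ae ?_
        filter_upwards [condExp_mul_of_stronglyMeasurable_left (hSm n) hprod (hξint n),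
          hmart n] with ω h1 h2
        have h1' : (μ[fun ω => S n ω * ξ n ω | ℱ n]) ω = S n ω * (μ[ξ n | ℱ n]) ω := h1
        rw [h1', h2]; simp
      have h1 : ∀ ω, S (n + 1) ω ^ 2 = S n ω ^ 2 + ξ n ω ^ 2 + 2 * (S n ω * ξ n ω) := fun ω => by
        rw [hSs, Pi.add_apply]; ring
      simp only [h1]
      have hadd : Integrable (fun ω => S n ω ^ 2 + ξ n ω ^ 2) μ :=
        (hS2 n).integrable_sq.add (hξ2 n).integrable_sq
      rw [integral_add hadd (hprod.const_mul 2),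
        integral_add (hS2 n).integrable_sq (hξ2 n).integrable_sq, integral_const_mul, h0,
        Finset.sum_range_succ]
      linarith [hle n]
  have hc0 : ∀ n, 0 ≤ c n := fun n => (integral_nonneg fun ω => sq_nonneg _).trans (hle n)
  have hbdd : ∀ n, eLpNorm (S n) 1 μ ≤ ((1 + ∑' k, c k).toNNReal : ℝ≥0∞) := fun n => by
    rw [eLpNorm_one_eq_lintegral_enorm, ← ofReal_integral_norm_eq_lintegral_enorm (hSint n)]
    refine ENNReal.ofReal_le_ofReal ?_
    calc ∫ ω, ‖S n ω‖ ∂μ ≤ ∫ ω, (1 + S n ω ^ 2) ∂μ := by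
          refine integral_mono (hSint n).norm ((integrable_const 1).add (hS2 n).integrable_sq)
            fun ω => ?_
          rw [Real.norm_eq_abs]
          nlinarith [sq_abs (S n ω), sq_nonneg (|S n ω| - 1)]
      _ = 1 + ∫ ω, S n ω ^ 2 ∂μ := by
          rw [integral_add (integrable_const 1) (hS2 n).integrable_sq]; simp
      _ ≤ _ := by
          gcongr
          exact (hsq n).trans (hc.sum_le_tsum _ fun k _ => hc0 k)
  exact hM.submartingale.exists_ae_tendsto_of_bdd hbdd

variable {E : Type*} [NormedAddCommGroup E] [NormedSpace ℝ E]

/-- Pairing a centred variable with a predictable functional gives a centred variable. -/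
theorem condExp_clm_apply_ae_eq_zero [CompleteSpace E] {m : MeasurableSpace Ω}
    {c : Ω → E →L[ℝ] ℝ} {X : Ω → E} (hc : StronglyMeasurable[m] c) (hc2 : MemLp c 2 μ)
    (hX2 : MemLp X 2 μ) (hX : μ[X | m] =ᵐ[μ] 0) :
    μ[fun ω => c ω (X ω) | m] =ᵐ[μ] 0 := by
  filter_upwards [condExp_bilin_of_stronglyMeasurable_left
    (ContinuousLinearMap.id ℝ (E →L[ℝ] ℝ)) hc (hc2.integrable_clm_apply hX2)
    (hX2.integrable one_le_two), hX] with ω h1 h2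
  have h1' : (μ[fun ω => c ω (X ω) | m]) ω = c ω ((μ[X | m]) ω) := h1
  rw [h1', h2]; simp

end Martingale

/-! ### Stability of the iterates and convergence of the noise. -/

theorem IsLocallyBounded.exists_forall_mem_le {E : Type*} [TopologicalSpace E] {f : E → ℝ}
    (hf : IsLocallyBounded f) {S : Set E} (hS : IsCompact S) : ∃ C, ∀ y ∈ S, f y ≤ C := by
  refine hS.induction_on (p := fun T => ∃ C, ∀ y ∈ T, f y ≤ C) ⟨0, by simp⟩
    (fun s t hst ⟨C, hC⟩ => ⟨C, fun y hy => hC y (hst hy)⟩) ?_ fun y _ => ?_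
  · rintro s t ⟨C, hC⟩ ⟨C', hC'⟩
    exact ⟨max C C', fun y hy => hy.elim (fun h => (hC y h).trans (le_max_left _ _))
      fun h => (hC' y h).trans (le_max_right _ _)⟩
  · obtain ⟨C, hC⟩ := hf y
    exact ⟨_, mem_nhdsWithin_of_mem_nhds hC, C, fun z hz => (le_abs_self _).trans hz⟩

section StochasticApproximation

variable {Ω : Type*} {mΩ : MeasurableSpace Ω} {μ : Measure Ω} [IsProbabilityMeasure μ]

/-- A square integrable truncation of a random vector, composed with a function of linear growth, stays
square integrable. -/
theorem MeasureTheory.MemLp.indicator_comp_of_linear_growth {E G : Type*} [NormedAddCommGroup E]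
    [NormedAddCommGroup G] {X : Ω → E} {B : Set Ω} (hB : MeasurableSet B)
    (hX : MemLp (B.indicator X) 2 μ) {F : E → G}
    (hFX : AEStronglyMeasurable (fun ω => F (X ω)) μ) {c : ℝ} (hF : ∀ y, ‖F y‖ ≤ c * (1 + ‖y‖)) :
    MemLp (B.indicator fun ω => F (X ω)) 2 μ := by
  have hc : 0 ≤ c := by
    have := (norm_nonneg _).trans (hF 0)
    simpa using this
  have h1 : MemLp (fun ω => c * (1 + ‖B.indicator X ω‖)) 2 μ :=
    ((memLp_const (1 : ℝ)).add hX.norm).const_mul c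
  refine h1.mono' (hFX.indicator hB) (Eventually.of_forall fun ω => ?_)
  by_cases hω : ω ∈ B
  · simpa [hω] using hF (X ω)
  · simpa [hω] using hc

variable {E : Type*} [NormedAddCommGroup E] [NormedSpace ℝ E] [FiniteDimensional ℝ E]

/-- Stability: a Lyapunov function with Lipschitz derivative stays bounded along the iterates. -/
theorem ae_bddAbove_range_lyapunov {ℱ : Filtration ℕ mΩ} {h : E → E} (hh : Continuous h)
    {a : ℕ → ℝ} (ha : ∀ n, 0 ≤ a n) (ha_sq : Summable fun n => a n ^ 2) {x M : ℕ → Ω → E}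
    (hxm : ∀ n, StronglyMeasurable[ℱ n] (x n))
    (hx : ∀ n ω, x (n + 1) ω = x n ω + a n • (h (x n ω) + M (n + 1) ω))
    (hM_sq : ∀ n, MemLp (M (n + 1)) 2 μ) (hM_mart : ∀ n, μ[M (n + 1) | ℱ n] =ᵐ[μ] 0)
    {f U : E → ℝ} (hf : ∀ y, 0 ≤ f y)
    (hM_var : ∀ n, μ[fun ω => ‖M (n + 1) ω‖ ^ 2 | ℱ n] ≤ᵐ[μ] fun ω => f (x n ω))
    (hU : Differentiable ℝ U) {C : NNReal} (hC : LipschitzWith C (fderiv ℝ U))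
    (hU0 : ∀ y, 0 ≤ U y) (hUh : ∀ y, fderiv ℝ U y (h y) ≤ 0) {c : ℝ}
    (hc : ∀ y, ‖h y‖ ^ 2 + f y ≤ c * (1 + U y)) :
    ∀ᵐ ω ∂μ, BddAbove (Set.range fun n => U (x n ω)) := by
  have hc0 : 0 ≤ c := by
    have h1 := (add_nonneg (sq_nonneg ‖h 0‖) (hf 0)).trans (hc 0)
    have h2 := hU0 0
    by_contra hneg
    nlinarith
  obtain ⟨c₁, hc₁0, hc₁⟩ : ∃ c₁ ≥ 0, ∀ y, ‖fderiv ℝ U y‖ ≤ c₁ * (1 + ‖y‖) := by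
    refine ⟨‖fderiv ℝ U 0‖ + C, by positivity, fun y => ?_⟩
    have h1 := norm_le_insert' (fderiv ℝ U y) (fderiv ℝ U 0)
    have h2 := hC.norm_sub_le y 0
    rw [sub_zero] at h2
    nlinarith [norm_nonneg y, norm_nonneg (fderiv ℝ U 0), C.2]
  obtain ⟨c₂, hc₂0, hc₂⟩ : ∃ c₂ ≥ 0, ∀ y, 1 + U y ≤ (c₂ * (1 + ‖y‖)) ^ 2 := by
    refine ⟨1 + U 0 + ‖fderiv ℝ U 0‖ + C, by have := hU0 0; positivity, fun y => ?_⟩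
    have h1 := hC.le_add_fderiv_add_sq hU 0 y
    have h2 := (le_abs_self _).trans ((fderiv ℝ U 0).le_opNorm y)
    rw [zero_add] at h1
    set D := ‖fderiv ℝ U 0‖
    have hD : 0 ≤ D := norm_nonneg _
    set s := ‖y‖
    have hs : 0 ≤ s := norm_nonneg _
    have h3 : (0 : ℝ) ≤ C := C.2
    have h4 := hU0 0
    have h5 : 1 + U y ≤ (1 + U 0 + D + C) * (1 + s) ^ 2 := by
      nlinarith [mul_nonneg h4 hs, mul_nonneg hD hs,
        mul_nonneg h3 hs, mul_nonneg h4 (sq_nonneg s), mul_nonneg hD (sq_nonneg s)]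
    -- The constant is at least 1, so it is bounded by its own square.
    have h6 : 1 ≤ 1 + U 0 + D + C := by linarith
    rw [mul_pow]
    refine h5.trans ?_
    gcongr
    nlinarith
  have hc₃ : ∀ y, ‖h y‖ ≤ Real.sqrt c * c₂ * (1 + ‖y‖) := fun y => by
    refine abs_le_of_sq_le_sq' ?_ (by positivity) |>.2
    calc ‖h y‖ ^ 2 ≤ c * (1 + U y) := by linarith [hc y, hf y]
      _ ≤ c * (c₂ * (1 + ‖y‖)) ^ 2 := by gcongr; exact hc₂ y
      _ = (Real.sqrt c * c₂ * (1 + ‖y‖)) ^ 2 := by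
          rw [mul_assoc, mul_pow (Real.sqrt c), Real.sq_sqrt hc0]
  have hmeas : ∀ n, StronglyMeasurable (x n) := fun n => (hxm n).mono (ℱ.le n)
  -- The initial state need not be integrable. Restricting to the `ℱ 0`-measurable event that it
  -- lies in a ball makes all iterates square integrable there, and countably many such events cover
  -- the space.
  have key : ∀ R : ℕ, ∀ᵐ ω ∂μ, ‖x 0 ω‖ ≤ R → BddAbove (Set.range fun n => U (x n ω)) := by
    intro R
    set B : Set Ω := {ω | ‖x 0 ω‖ ≤ R} with hBdef
    have hB : ∀ n, MeasurableSet[ℱ n] B := fun n => ℱ.mono (Nat.zero_le n) _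
      ((hxm 0).norm.measurableSet_le stronglyMeasurable_const)
    have hB' : MeasurableSet B := ℱ.le 0 _ (hB 0)
    have hhx : ∀ n, StronglyMeasurable[ℱ n] fun ω => h (x n ω) := fun n =>
      hh.comp_stronglyMeasurable (hxm n)
    have hDx : ∀ n, StronglyMeasurable[ℱ n] fun ω => fderiv ℝ U (x n ω) := fun n =>
      hC.continuous.comp_stronglyMeasurable (hxm n)
    have hUx : ∀ n, StronglyMeasurable[ℱ n] fun ω => U (x n ω) := fun n =>
      hU.continuous.comp_stronglyMeasurable (hxm n)
    have hx2 : ∀ n, MemLp (B.indicator (x n)) 2 μ := by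
      intro n
      induction n with
      | zero =>
        refine MemLp.of_bound ((hmeas 0).indicator hB').aestronglyMeasurable R
          (Eventually.of_forall fun ω => ?_)
        by_cases hω : ω ∈ B
        · rw [Set.indicator_of_mem hω]
          exact hω
        · simp [hω]
      | succ n ih =>
        have e : B.indicator (x (n + 1)) = B.indicator (x n) +
            a n • (B.indicator (fun ω => h (x n ω)) + B.indicator (M (n + 1))) := by
          funext ω
          by_cases hω : ω ∈ B <;> simp [hω, hx]
        rw [e]
        exact ih.add (((ih.indicator_comp_of_linear_growth hB'
          ((hhx n).mono (ℱ.le n)).aestronglyMeasurable hc₃).add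
          ((hM_sq n).indicator hB')).const_smul _)
    have hh2 : ∀ n, MemLp (B.indicator fun ω => h (x n ω)) 2 μ := fun n =>
      (hx2 n).indicator_comp_of_linear_growth hB'
        ((hhx n).mono (ℱ.le n)).aestronglyMeasurable hc₃
    have hD2 : ∀ n, MemLp (B.indicator fun ω => fderiv ℝ U (x n ω)) 2 μ := fun n =>
      (hx2 n).indicator_comp_of_linear_growth hB'
        ((hDx n).mono (ℱ.le n)).aestronglyMeasurable hc₁
    set V : ℕ → Ω → ℝ := fun n => B.indicator fun ω => 1 + U (x n ω) with hV
    have hVm : StronglyAdapted ℱ V := fun n =>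
      (stronglyMeasurable_const.add (hUx n)).indicator (hB n)
    have hV0 : ∀ n ω, 0 ≤ V n ω := fun n ω =>
      Set.indicator_nonneg (fun ω _ => by linarith [hU0 (x n ω)]) ω
    have hVint : ∀ n, Integrable (V n) μ := fun n => by
      have h1 : MemLp (fun ω => c₂ * (1 + ‖B.indicator (x n) ω‖)) 2 μ :=
        ((memLp_const (1 : ℝ)).add (hx2 n).norm).const_mul c₂
      refine h1.integrable_sq.mono' ((hVm n).mono (ℱ.le n)).aestronglyMeasurable
        (Eventually.of_forall fun ω => ?_)
      rw [Real.norm_of_nonneg (hV0 n ω)]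
      by_cases hω : ω ∈ B
      · simpa [hV, hω] using hc₂ (x n ω)
      · simp only [hV, hω, not_false_eq_true, Set.indicator_of_notMem]
        positivity
    have hrec : ∀ n, μ[V (n + 1) | ℱ n] ≤ᵐ[μ] fun ω => (1 + 2 * C * c * a n ^ 2) * V n ω := by
      intro n
      -- The one-step bound splits into an `ℱ n`-measurable part `P`, a centred part `Q` and the
      -- squared noise `S`; the first-order drift term is nonpositive and is dropped.
      set P : Ω → ℝ := V n + (2 * C * a n ^ 2) • B.indicator (fun ω => ‖h (x n ω)‖ ^ 2) with hP
      set D : Ω → E →L[ℝ] ℝ := a n • B.indicator (fun ω => fderiv ℝ U (x n ω)) with hD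
      set Q : Ω → ℝ := fun ω => D ω (M (n + 1) ω) with hQ
      set S : Ω → ℝ := B.indicator fun ω => ‖M (n + 1) ω‖ ^ 2 with hS
      have hPm : StronglyMeasurable[ℱ n] P :=
        (hVm n).add ((((hhx n).norm.pow 2).indicator (hB n)).const_smul _)
      have hPint : Integrable P μ := by
        refine (hVint n).add (Integrable.smul _ ?_)
        have := (hh2 n).norm.integrable_sq
        refine this.congr (Eventually.of_forall fun ω => ?_)
        by_cases hω : ω ∈ B <;> simp [hω]
      have hD2' : MemLp D 2 μ := (hD2 n).const_smul _
      have hQint : Integrable Q μ := hD2'.integrable_clm_apply (hM_sq n)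
      have hMint : Integrable (fun ω => ‖M (n + 1) ω‖ ^ 2) μ := (hM_sq n).norm.integrable_sq
      have hSint : Integrable S μ := hMint.indicator hB'
      have hstep : V (n + 1) ≤ P + Q + (2 * C * a n ^ 2) • S := fun ω => by
        by_cases hω : ω ∈ B
        · simp only [hV, hP, hQ, hS, hD, Pi.add_apply, Pi.smul_apply, smul_eq_mul, hω,
            Set.indicator_of_mem, smul_apply]
          have h1 := hC.le_add_fderiv_add_sq hU (x n ω) (a n • (h (x n ω) + M (n + 1) ω))
          rw [← hx, map_smul, map_add, norm_smul, Real.norm_of_nonneg (ha n), smul_eq_mul] at h1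
          have h2 : ‖h (x n ω) + M (n + 1) ω‖ ^ 2 ≤ 2 * (‖h (x n ω)‖ ^ 2 + ‖M (n + 1) ω‖ ^ 2) := by
            have := norm_add_le (h (x n ω)) (M (n + 1) ω)
            calc _ ≤ (‖h (x n ω)‖ + ‖M (n + 1) ω‖) ^ 2 := by gcongr
              _ ≤ _ := add_sq_le
          have h3 : C * (a n * ‖h (x n ω) + M (n + 1) ω‖) ^ 2 ≤
              C * a n ^ 2 * (2 * (‖h (x n ω)‖ ^ 2 + ‖M (n + 1) ω‖ ^ 2)) := by
            rw [mul_pow, ← mul_assoc]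
            gcongr
          have h4 := mul_nonpos_of_nonneg_of_nonpos (ha n) (hUh (x n ω))
          linarith
        · simp [hV, hP, hQ, hS, hD, hω]
      have hE1 := condExp_mono (m := ℱ n) (hVint (n + 1))
        ((hPint.add hQint).add (hSint.smul (2 * C * a n ^ 2))) (Eventually.of_forall hstep)
      filter_upwards [hE1, condExp_add (hPint.add hQint) (hSint.smul (2 * C * a n ^ 2)) (ℱ n),
        condExp_add hPint hQint (ℱ n), condExp_smul (2 * C * a n ^ 2 : ℝ) S (ℱ n) (μ := μ),
        condExp_clm_apply_ae_eq_zero (((hDx n).indicator (hB n)).const_smul (a n)) hD2' (hM_sq n)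
          (hM_mart n), condExp_indicator hMint (hB n), hM_var n] with ω e1 e2 e3 e4 e5 e6 e7
      have e5' : (μ[Q | ℱ n]) ω = 0 := e5
      rw [e2, Pi.add_apply, e3, Pi.add_apply, e4, e5', Pi.smul_apply, e6,
        condExp_of_stronglyMeasurable (ℱ.le n) hPm hPint] at e1
      refine e1.trans ?_
      by_cases hω : ω ∈ B
      · simp only [hV, hP, Pi.add_apply, Pi.smul_apply, smul_eq_mul, hω, Set.indicator_of_mem]
        have h1 : 2 * C * a n ^ 2 * (‖h (x n ω)‖ ^ 2 +
            (μ[fun ω => ‖M (n + 1) ω‖ ^ 2 | ℱ n]) ω) ≤ 2 * C * a n ^ 2 * (c * (1 + U (x n ω))) := by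
          gcongr
          linarith [hc (x n ω)]
        linarith
      · simp [hV, hP, hω]
    filter_upwards [ae_bddAbove_range_of_condExp_le hVm hVint hV0
      (fun n => by positivity) (ha_sq.mul_left (2 * C * c)) hrec] with ω ⟨b, hb⟩ hω
    refine ⟨b, ?_⟩
    rintro _ ⟨n, rfl⟩
    have h1 : V n ω ≤ b := hb ⟨n, rfl⟩
    have h2 : V n ω = 1 + U (x n ω) := Set.indicator_of_mem (s := B) hω _
    simp only
    linarith
  filter_upwards [ae_all_iff.2 key] with ω hω
  obtain ⟨R, hR⟩ := exists_nat_ge ‖x 0 ω‖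
  exact hω R hR

/-- The weighted noise converges almost surely along bounded trajectories. -/
theorem ae_cauchySeq_sum_noise {ℱ : Filtration ℕ mΩ} {a : ℕ → ℝ}
    (ha_sq : Summable fun n => a n ^ 2) {x M : ℕ → Ω → E}
    (hxm : ∀ n, StronglyMeasurable[ℱ n] (x n))
    (hMm : ∀ n, StronglyMeasurable[ℱ (n + 1)] (M (n + 1)))
    (hM_sq : ∀ n, MemLp (M (n + 1)) 2 μ) (hM_mart : ∀ n, μ[M (n + 1) | ℱ n] =ᵐ[μ] 0)
    {f : E → ℝ} (hf : ∀ y, 0 ≤ f y) (hf_bdd : IsLocallyBounded f)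
    (hM_var : ∀ n, μ[fun ω => ‖M (n + 1) ω‖ ^ 2 | ℱ n] ≤ᵐ[μ] fun ω => f (x n ω)) :
    ∀ᵐ ω ∂μ, (∃ R, ∀ n, ‖x n ω‖ ≤ R) →
      CauchySeq fun n => ∑ k ∈ Finset.range n, a k • M (k + 1) ω := by
  have : ProperSpace E := FiniteDimensional.proper ℝ E
  set e := (Module.finBasis ℝ E).equivFunL with he
  have key : ∀ (R : ℕ) (i : Fin (Module.finrank ℝ E)), ∀ᵐ ω ∂μ, (∀ n, ‖x n ω‖ ≤ R) →
      ∃ l, Tendsto (fun n => e (∑ k ∈ Finset.range n, a k • M (k + 1) ω) i) atTop (𝓝 l) := by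
    intro R i
    set p : E →L[ℝ] ℝ := (ContinuousLinearMap.proj (R := ℝ) (φ := fun _ => ℝ) i).comp
      (e : E →L[ℝ] (Fin (Module.finrank ℝ E) → ℝ)) with hp
    obtain ⟨F, hF⟩ := hf_bdd.exists_forall_mem_le (isCompact_closedBall (0 : E) R)
    have hF0 : 0 ≤ F := (hf 0).trans (hF 0 (by simp))
    set B : ℕ → Set Ω := fun k => {ω | ‖x k ω‖ ≤ R} with hBdef
    have hB : ∀ k, MeasurableSet[ℱ k] (B k) := fun k =>
      (hxm k).norm.measurableSet_le stronglyMeasurable_const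
    -- Each noise coordinate is truncated by the predictable event that the current iterate lies in
    -- the ball, where `f ≤ F` bounds the conditional variance.
    set c : ℕ → Ω → E →L[ℝ] ℝ := fun k => (B k).indicator fun _ => a k • p with hcdef
    have hcm : ∀ k, StronglyMeasurable[ℱ k] (c k) := fun k =>
      stronglyMeasurable_const.indicator (hB k)
    have hc2 : ∀ k, MemLp (c k) 2 μ := fun k =>
      (memLp_const (a k • p)).indicator (ℱ.le k _ (hB k))
    have hMint : ∀ k, Integrable (fun ω => ‖M (k + 1) ω‖ ^ 2) μ := fun k =>
      (hM_sq k).norm.integrable_sq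
    have hle : ∀ k ω, ‖c k ω (M (k + 1) ω)‖ ≤ |a k| * ‖p‖ * ‖(B k).indicator (M (k + 1)) ω‖ := by
      intro k ω
      by_cases hω : ω ∈ B k
      · simp only [hcdef, hω, Set.indicator_of_mem, smul_apply, norm_smul, Real.norm_eq_abs (a k)]
        rw [mul_assoc]
        gcongr
        exact p.le_opNorm _
      · simp [hcdef, hω]
    have hξm : ∀ k, StronglyMeasurable[ℱ (k + 1)] fun ω => c k ω (M (k + 1) ω) := fun k =>
      (ContinuousLinearMap.id ℝ (E →L[ℝ] ℝ)).isBoundedBilinearMap.continuous.comp_stronglyMeasurable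
        (((hcm k).mono (ℱ.mono k.le_succ)).prodMk (hMm k))
    have hξ2 : ∀ k, MemLp (fun ω => c k ω (M (k + 1) ω)) 2 μ := fun k =>
      (((hM_sq k).indicator (ℱ.le k _ (hB k))).norm.const_mul (|a k| * ‖p‖)).mono'
        ((hξm k).mono (ℱ.le _)).aestronglyMeasurable (Eventually.of_forall (hle k))
    have hsq : ∀ k, ∫ ω, c k ω (M (k + 1) ω) ^ 2 ∂μ ≤ ‖p‖ ^ 2 * F * a k ^ 2 := by
      intro k
      have h1 : ∫ ω in B k, ‖M (k + 1) ω‖ ^ 2 ∂μ ≤ F := by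
        rw [← setIntegral_condExp (ℱ.le k) (hMint k) (hB k)]
        calc ∫ ω in B k, (μ[fun ω => ‖M (k + 1) ω‖ ^ 2 | ℱ k]) ω ∂μ ≤ ∫ _ in B k, F ∂μ := by
              refine setIntegral_mono_on_ae integrable_condExp.integrableOn
                (integrable_const F).integrableOn (ℱ.le k _ (hB k)) ?_
              filter_upwards [hM_var k] with ω h1 hω
              exact h1.trans (hF _ (mem_closedBall_zero_iff.2 hω))
          _ ≤ F := by
              rw [setIntegral_const, smul_eq_mul]
              exact mul_le_of_le_one_left hF0 measureReal_le_one
      calc ∫ ω, c k ω (M (k + 1) ω) ^ 2 ∂μ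
          ≤ ∫ ω, ‖p‖ ^ 2 * a k ^ 2 * (B k).indicator (fun ω => ‖M (k + 1) ω‖ ^ 2) ω ∂μ := by
            refine integral_mono (hξ2 k).integrable_sq
              (((hMint k).indicator (ℱ.le k _ (hB k))).const_mul _) fun ω => ?_
            have h2 := pow_le_pow_left₀ (norm_nonneg _) (hle k ω) 2
            rw [Real.norm_eq_abs, sq_abs, mul_pow, mul_pow, sq_abs] at h2
            refine h2.trans (le_of_eq ?_)
            by_cases hω : ω ∈ B k
            · simp only [hω, Set.indicator_of_mem]; ring
            · simp [hω]
        _ ≤ ‖p‖ ^ 2 * F * a k ^ 2 := by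
            rw [integral_const_mul, integral_indicator (ℱ.le k _ (hB k))]
            calc _ ≤ ‖p‖ ^ 2 * a k ^ 2 * F := by gcongr
              _ = _ := by ring
    filter_upwards [ae_exists_tendsto_sum_of_martingale_diff hξm hξ2
      (fun k => condExp_clm_apply_ae_eq_zero (hcm k) (hc2 k) (hM_sq k) (hM_mart k))
      (ha_sq.mul_left (‖p‖ ^ 2 * F)) hsq] with ω ⟨l, hl⟩ hω
    refine ⟨l, hl.congr fun n => ?_⟩
    have h1 : e (∑ k ∈ Finset.range n, a k • M (k + 1) ω) i =
        p (∑ k ∈ Finset.range n, a k • M (k + 1) ω) := rfl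
    rw [h1, map_sum]
    refine Finset.sum_congr rfl fun k _ => ?_
    have hωk : ω ∈ B k := hω k
    simp [hcdef, hωk]
  filter_upwards [ae_all_iff.2 fun R => ae_all_iff.2 (key R)] with ω hω hbdd
  obtain ⟨R, hR⟩ := hbdd
  obtain ⟨R', hR'⟩ := exists_nat_ge R
  choose l hl using fun i => hω R' i fun n => (hR n).trans hR'
  have h1 : Tendsto (fun n => e (∑ k ∈ Finset.range n, a k • M (k + 1) ω)) atTop (𝓝 l) :=
    tendsto_pi_nhds.2 hl
  have h2 := (e.symm.continuous.tendsto l).comp h1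
  simp only [Function.comp_def, ContinuousLinearEquiv.symm_apply_apply] at h2
  exact h2.cauchySeq

end StochasticApproximation

/-! ### The noise filtration and the final assembly. -/

/-- The filtration generated by the initial state and the noise. -/
def noiseFiltration {Ω E : Type*} [mΩ : MeasurableSpace Ω] [MeasurableSpace E] {x₀ : Ω → E}
    {M : ℕ → Ω → E} (hx₀ : Measurable x₀) (hM : ∀ n, Measurable (M (n + 1))) :
    Filtration ℕ mΩ where
  seq := noiseSigma x₀ M
  mono' := fun _ _ hmn => sup_le_sup_left
    (biSup_mono fun _ hk => Finset.Icc_subset_Icc_right hmn hk) _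
  le' := fun n => sup_le hx₀.comap_le <| iSup₂_le fun k hk => by
    obtain ⟨j, rfl⟩ : ∃ j, k = j + 1 := ⟨k - 1, by have := (Finset.mem_Icc.1 hk).1; omega⟩
    exact (hM j).comap_le

theorem measurable_noise {Ω E : Type*} [MeasurableSpace E] (x₀ : Ω → E)
    (M : ℕ → Ω → E) (n : ℕ) : Measurable[noiseSigma x₀ M (n + 1)] (M (n + 1)) :=
  Measurable.of_comap_le <| le_sup_of_le_right <|
    le_iSup₂_of_le (n + 1) (Finset.mem_Icc.2 ⟨by omega, le_rfl⟩) le_rfl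

theorem measurable_iterate {Ω E : Type*} [MeasurableSpace E] [NormedAddCommGroup E]
    [NormedSpace ℝ E] [BorelSpace E] [SecondCountableTopology E] {h : E → E} (hh : Measurable h)
    {a : ℕ → ℝ} {x M : ℕ → Ω → E}
    (hx : ∀ n ω, x (n + 1) ω = x n ω + a n • (h (x n ω) + M (n + 1) ω)) (n : ℕ) :
    Measurable[noiseSigma (x 0) M n] (x n) := by
  induction n with
  | zero => exact Measurable.of_comap_le le_sup_left
  | succ n ih =>
    have hle : noiseSigma (x 0) M n ≤ noiseSigma (x 0) M (n + 1) := sup_le_sup_left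
      (biSup_mono fun _ hk => Finset.Icc_subset_Icc_right n.le_succ hk) _
    have ih' := ih.mono hle le_rfl
    rw [show x (n + 1) = fun ω => x n ω + a n • (h (x n ω) + M (n + 1) ω) from funext (hx n)]
    let := noiseSigma (x 0) M (n + 1)
    exact ih'.add (((hh.comp ih').add (measurable_noise (x 0) M n)).const_smul (a n))

theorem mainTheorem4 {d : ℕ} {Ω : Type*} [MeasurableSpace Ω]
    (μ : Measure Ω) [IsProbabilityMeasure μ]
    (h : EuclideanSpace ℝ (Fin d) → EuclideanSpace ℝ (Fin d))
    (a : ℕ → ℝ)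
    (x M : ℕ → Ω → EuclideanSpace ℝ (Fin d))
    (f W : EuclideanSpace ℝ (Fin d) → ℝ) (L : ℕ)
    -- the iterates `x (n + 1) = x n + a n (h (x n) + M (n + 1))`
    (hx0 : Measurable (x 0))
    (hx : ∀ n ω, x (n + 1) ω = x n ω + a n • (h (x n ω) + M (n + 1) ω))
    -- (A1)
    (hh : LocallyLipschitz h)
    -- (A2)
    (ha_nonneg : ∀ n, 0 ≤ a n)
    (ha_sum : Tendsto (fun n => ∑ i ∈ Finset.range n, a i) atTop atTop)
    (ha_sq : Summable (fun n => a n ^ 2))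
    -- (A3)
    (hM_meas : ∀ n, Measurable (M (n + 1)))
    (hM_sq : ∀ n, MemLp (M (n + 1)) 2 μ)
    (hM_mart : ∀ n, μ[M (n + 1) | noiseSigma (x 0) M n] =ᵐ[μ] 0)
    (hf_nonneg : ∀ y, 0 ≤ f y) (hf_meas : Measurable f) (hf_bdd : IsLocallyBounded f)
    (hM_var : ∀ n, μ[fun ω => ‖M (n + 1) ω‖ ^ 2 | noiseSigma (x 0) M n]
      ≤ᵐ[μ] fun ω => f (x n ω))
    -- (A4)
    (hW_nonneg : ∀ y, 0 ≤ W y)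
    (hW_lim : Tendsto W (Bornology.cobounded (EuclideanSpace ℝ (Fin d))) atTop)
    (hL : 0 < L)
    (hW_desc : ∀ y, (L : ℝ) ≤ W y → inner ℝ (h y) (gradient W y) < 0)
    -- (A5)
    (hW_C2 : ContDiff ℝ 2 W)
    (hW_second : HasBoundedSecondDerivatives W)
    -- the growth condition
    (h_growth : BddAbove (Set.range fun y => (‖h y‖ ^ 2 + f y) / max 1 (W y))) :
    (∃ c : ℝ, IsAdmissibleScaling h f W L ⊤ c (fun _ => 1)) ∧
    ∀ᵐ ω ∂μ, ∃ A : Set (EuclideanSpace ℝ (Fin d)),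
      IsInternallyChainTransitive h A ∧
      Tendsto (fun n => Metric.infDist (x n ω) A) atTop (𝓝 0) := by
  obtain ⟨G, hG⟩ := h_growth
  have hG' : ∀ y, (‖h y‖ ^ 2 + f y) / max 1 (W y) ≤ G := fun y => hG ⟨y, rfl⟩
  refine ⟨⟨max 1 G + 1, ?_⟩, ?_⟩
  · refine ⟨ENat.natCast_lt_top L, by linarith [le_max_left 1 G], ⟨max 1 G, by linarith, ?_⟩,
      measurable_const, fun _ => ⟨1, by simp⟩, fun _ => le_rfl, fun y hy => ?_⟩
    · rintro y ⟨-, hy⟩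
      have h1 : (L : ℝ) ≤ W y := by
        by_contra hlt
        refine hy ?_
        simp only [levelSet, Set.mem_ofPred_eq]
        rw [ENNReal.ofReal_lt_iff_lt_toReal (hW_nonneg y) (by simp)]
        simpa using hlt
      -- Positivity of the integer level gives `1 ≤ W y`, so the maximum in the growth condition is
      -- `W y` itself.
      have h2 : (1 : ℝ) ≤ L := by exact_mod_cast hL
      have h3 := hG' y
      rw [max_eq_right (h2.trans h1)] at h3
      exact h3.trans (le_max_right _ _)
    -- At level `∞` the square root condition is vacuous.
    · simp at hy
  · obtain ⟨K, hK⟩ := hW_second.exists_lipschitzWith_fderiv hW_C2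
    obtain ⟨U, w, C, hU, hC, hU0, hWU, hw0, hwL, hUw⟩ := exists_flattened_lyapunov
      (hW_C2.differentiable (by norm_num)) hK hW_lim L
    have hgrowth : ∀ y, ‖h y‖ ^ 2 + f y ≤ |G| * (L + 2) * (1 + U y) := fun y => by
      -- The factor `L + 2` comes from `W ≤ U + L + 1`, which converts growth relative to `W` into
      -- growth relative to `1 + U`.
      have h1 : (0 : ℝ) < max 1 (W y) := lt_of_lt_of_le one_pos (le_max_left _ _)
      have h2 := (div_le_iff₀ h1).1 (hG' y)
      have h3 : max 1 (W y) ≤ (L + 2) * (1 + U y) := by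
        have := hU0 y
        have h4 : (0 : ℝ) ≤ L := Nat.cast_nonneg L
        have h5 := mul_nonneg h4 this
        refine max_le (by nlinarith) (by nlinarith [hWU y])
      calc _ ≤ G * max 1 (W y) := h2
        _ ≤ |G| * ((L + 2) * (1 + U y)) := by
            gcongr
            exact le_abs_self G
        _ = _ := by ring
    have hdesc : ∀ y, fderiv ℝ U y (h y) ≤ 0 := fun y => by
      rw [hUw, smul_apply, smul_eq_mul]
      rcases lt_or_ge (W y) L with hy | hy
      · simp [hwL y hy]
      · refine mul_nonpos_of_nonneg_of_nonpos (hw0 y) ?_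
        have := hW_desc y hy
        rw [real_inner_comm, inner_gradient_left] at this
        exact this.le
    set ℱ := noiseFiltration hx0 hM_meas
    have hxm : ∀ n, StronglyMeasurable[ℱ n] (x n) := fun n =>
      (measurable_iterate hh.continuous.measurable hx n).stronglyMeasurable
    have hMm : ∀ n, StronglyMeasurable[ℱ (n + 1)] (M (n + 1)) := fun n =>
      (measurable_noise (x 0) M n).stronglyMeasurable
    filter_upwards [ae_bddAbove_range_lyapunov (ℱ := ℱ) hh.continuous ha_nonneg ha_sq hxm hx hM_sq
      hM_mart hf_nonneg hM_var hU hC hU0 hdesc hgrowth, ae_cauchySeq_sum_noise (ℱ := ℱ) ha_sq hxm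
      hMm hM_sq hM_mart hf_nonneg hf_bdd hM_var] with ω ⟨b, hb⟩ hcauchy
    obtain ⟨R, hR⟩ : ∃ R, ∀ n, ‖x n ω‖ ≤ R := by
      have := hW_lim.eventually_gt_atTop (b + L + 1)
      have hbd : Bornology.IsBounded {y | W y ≤ b + L + 1} := Bornology.isBounded_def.2 (by
        filter_upwards [this] with y hy using not_le.2 hy)
      obtain ⟨R, hR⟩ := hbd.exists_norm_le
      exact ⟨R, fun n => hR _ (by
        have h1 : U (x n ω) ≤ b := hb ⟨n, rfl⟩
        simp only [Set.mem_ofPred_eq]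
        linarith [hWU (x n ω)])⟩
    have ha0 : Tendsto a atTop (𝓝 0) := by
      have := (Real.continuous_sqrt.tendsto 0).comp ha_sq.tendsto_atTop_zero
      simpa [Function.comp_def, Real.sqrt_sq (ha_nonneg _)] using this
    -- The perturbation `z` consists of the partial sums of the weighted noise, and the attracting
    -- set is the set of cluster points of the path.
    obtain ⟨h1, h2⟩ := isInternallyChainTransitive_mapClusterPt hh ha_nonneg ha0 ha_sum
      (hcauchy ⟨R, hR⟩) (fun n => by
        rw [hx, Finset.sum_range_succ, add_sub_cancel_left, smul_add, add_assoc]) hR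
    exact ⟨_, h1, h2⟩
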